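/- A Lattès map is a rational map $f\colon\widehat{\mathbb C}\to\widehat{\mathbb C}$ whose local degree at every critical point is $2$ and whose postcritical set $P_f=\{f^n(c): c \text{ critical},\ n\ge 1\}$ has exactly four points, none of which is critical. For a four-point set $S\subset\widehat{\mathbb C}$, call $\wp\colon\mathbb C\to\widehat{\mathbb C}$ a branched cover of type $S$ if $\wp$ is an analytic branched cover whose local degree is $2$ at every point of $\wp^{-1}(S)$ and $1$ at every other point of $\mathbb C$; its set of branch points is then $\wp^{-1}(S)$. A branched cover for a Lattès map $f$ is a branched cover of type $P_f$, and $\widetilde f\colon\mathbb C\to\mathbb C$ is a lift of $f$ if $\wp\circ\widetilde f=f\circ\wp$. Two maps $f,f_0$ are analytically conjugate if $f_0=\sigma\circ f\circ\sigma^{-1}$ for some Möbius transformation $\sigma$. **Lemma 1.1.** Let $f$ be a Lattès map, let $\wp$ be a branched cover for $f$ with set of branch points $\Lambda$, where $0\in\Lambda$, and suppose that $\widetilde f(z)=\alpha z+\beta$ is a lift of $f$ (with $\alpha,\beta\in\mathbb C$). Let $f_0$ be a Lattès map which is analytically conjugate to $f$, let $\wp_0$ be a branched cover for $f_0$ with set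 of branch points $\Lambda_0$, where $0\in\Lambda_0$, and suppose that $\widetilde f_0(z)=\alpha_0z+\beta_0$ is a lift of $f_0$ through $\wp_0$. Then there is $\gamma\in\mathbb C^\times$ such that 1. $\alpha_0=\alpha$ or $\alpha_0=-\alpha$; 2. $\beta_0=\gamma\beta+\delta$ for some $\delta\in(\alpha+1)\Lambda_0+2\Lambda_0$; 3. $\Lambda_0=\gamma\Lambda$, with the same $\gamma$ as in 2. Conversely, let $S_0\subset\widehat{\mathbb C}$ be a set of four points, let $\wp_0$ be a branched cover of type $S_0$ with set of branch points $\Lambda_0$, where $0\in\Lambda_0$, and let $\alpha_0,\beta_0\in\mathbb C$ be such that 1, 2 and 3 hold for some $\gamma\in\mathbb C^\times$. Then $\widetilde f_0(z)=\alpha_0z+\beta_0$ is a lift through $\wp_0$ of a Lattès map $f_0$ which is analytically conjugate to $f$ and has $P_{f_0}=S_0$. -/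

import Mathlib

open scoped OnePoint Pointwise Polynomial MatrixGroups

noncomputable section

/-! The Riemann sphere is `OnePoint ℂ`, with the topology of the one-point compactification. -/

/-- The standard holomorphic coordinate of the Riemann sphere centred at `q`: it is `w ↦ w - a` if
`q = a` is finite, and `w ↦ 1 / w` (with `∞ ↦ 0`) if `q = ∞`. Only its values near `q` matter; the
value `0` that it has at the one point where the formula makes no sense is a placeholder. -/
def coordAt (q w : OnePoint ℂ) : ℂ :=
  q.elim (w.elim 0 fun b => b⁻¹) fun a => w.elim 0 fun b => b - a

/-- The standard holomorphic parametrization of the Riemann sphere near `q`, with `0 ↦ q`; it is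
the local inverse of `coordAt q`. -/
def paramAt (q : OnePoint ℂ) (t : ℂ) : OnePoint ℂ :=
  q.elim (if t = 0 then ∞ else ((t⁻¹ : ℂ) : OnePoint ℂ)) fun a => ((a + t : ℂ) : OnePoint ℂ)

/-- A map from the complex plane to the Riemann sphere is holomorphic if it is continuous and
holomorphic in the standard coordinates of the sphere. -/
def IsHolomorphicToSphere (g : ℂ → OnePoint ℂ) : Prop :=
  Continuous g ∧ ∀ z : ℂ, AnalyticAt ℂ (fun t => coordAt (g z) (g t)) z

/-- The local degree at `z` of a holomorphic map from the plane to the sphere: the order of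
vanishing at `z` of the map read in a coordinate centred at its value
(`⊤` if the map is constant near `z`). -/
def localDegree (g : ℂ → OnePoint ℂ) (z : ℂ) : ℕ∞ :=
  analyticOrderAt (fun t => coordAt (g z) (g t)) z

/-- The local degree at `q` of a holomorphic self-map of the Riemann sphere. -/
def sphereLocalDegree (f : OnePoint ℂ → OnePoint ℂ) (q : OnePoint ℂ) : ℕ∞ :=
  localDegree (fun t => f (paramAt q t)) 0

/-- `f` is a rational function `P / Q` (with `P`, `Q` coprime polynomials) as a self-map of the
Riemann sphere. The value at `∞` is the ratio of the coefficients of degree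
`n = max (deg P) (deg Q)`, read as `∞` when the coefficient of `Q` vanishes. -/
def IsRationalMap (f : OnePoint ℂ → OnePoint ℂ) : Prop :=
  ∃ P Q : ℂ[X], IsCoprime P Q ∧
    (∀ z : ℂ, f (z : OnePoint ℂ) =
      if Q.eval z = 0 then ∞ else ((P.eval z / Q.eval z : ℂ) : OnePoint ℂ)) ∧
    f ∞ = if Q.coeff (max P.natDegree Q.natDegree) = 0 then ∞ else
      ((P.coeff (max P.natDegree Q.natDegree) / Q.coeff (max P.natDegree Q.natDegree) : ℂ) :
        OnePoint ℂ)

/-- The critical points of a self-map of the sphere. -/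
def criticalPoints (f : OnePoint ℂ → OnePoint ℂ) : Set (OnePoint ℂ) :=
  {q | 1 < sphereLocalDegree f q}

/-- The postcritical set: all points `f^n(c)` with `c` critical and `n ≥ 1`. -/
def postcriticalSet (f : OnePoint ℂ → OnePoint ℂ) : Set (OnePoint ℂ) :=
  {q | ∃ c ∈ criticalPoints f, ∃ n : ℕ, 1 ≤ n ∧ f^[n] c = q}

/-- A Lattès map: a rational self-map of the Riemann sphere with local degree 2 at every critical
point and with exactly four postcritical points, none of which is critical. -/
structure IsLattes (f : OnePoint ℂ → OnePoint ℂ) : Prop where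
  rational : IsRationalMap f
  simple : ∀ c ∈ criticalPoints f, sphereLocalDegree f c = 2
  four : (postcriticalSet f).ncard = 4
  not_critical : ∀ q ∈ postcriticalSet f, q ∉ criticalPoints f

/-- `f₀ = σ ∘ f ∘ σ⁻¹` for some Möbius transformation `σ`. -/
def AnalyticallyConjugate (f f₀ : OnePoint ℂ → OnePoint ℂ) : Prop :=
  ∃ σ : GL (Fin 2) ℂ, ∀ q : OnePoint ℂ, f₀ q = σ • f (σ⁻¹ • q)

/-- A branched cover: every point `y` of the target has an open neighbourhood `U` with a coordinate
`ψ : U ≃ {|z| < 1}`, `ψ y = 0`, such that each connected component of the preimage of `U` has a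
coordinate onto the unit disc in which the map is `z ↦ z ^ k` for some `k ≥ 1`. -/
def IsBranchedCover {X Y : Type*} [TopologicalSpace X] [TopologicalSpace Y] (p : X → Y) : Prop :=
  Function.Surjective p ∧
  ∀ y : Y, ∃ ψ : OpenPartialHomeomorph Y ℂ,
    y ∈ ψ.source ∧ ψ y = 0 ∧ ψ.target = Metric.ball 0 1 ∧
    ∀ x ∈ p ⁻¹' ψ.source, ∃ k : ℕ, 1 ≤ k ∧ ∃ φ : OpenPartialHomeomorph X ℂ,
      φ.source = connectedComponentIn (p ⁻¹' ψ.source) x ∧ φ.target = Metric.ball 0 1 ∧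
      ∀ v ∈ φ.source, ψ (p v) = φ v ^ k

/-- `p : ℂ → Ĉ` is an analytic branched cover which is branched exactly over the points of `S`,
with local degree 2 at every point over `S` (and hence local degree 1 at all other points). -/
structure IsDoublyBranchedCover (p : ℂ → OnePoint ℂ) (S : Set (OnePoint ℂ)) : Prop where
  holomorphic : IsHolomorphicToSphere p
  branchedCover : IsBranchedCover p
  degree_over : ∀ z : ℂ, p z ∈ S → localDegree p z = 2
  degree_off : ∀ z : ℂ, p z ∉ S → localDegree p z = 1

/-- The set of branch points (in the plane) of a map from the plane to the sphere. -/
def branchPoints (p : ℂ → OnePoint ℂ) : Set ℂ := {z | 1 < localDegree p z}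

/-- Through `p`, the affine map `z ↦ α z + β` is a lift of `f`. -/
def IsAffineLift (p : ℂ → OnePoint ℂ) (f : OnePoint ℂ → OnePoint ℂ) (α β : ℂ) : Prop :=
  ∀ z : ℂ, p (α * z + β) = f (p z)

/-- The three relations between `(α, β, Λ)` and `(α₀, β₀, Λ₀)`, with the same `γ` in the last
two. -/
def LiftDataRelated (α β : ℂ) (Λ : Set ℂ) (α₀ β₀ : ℂ) (Λ₀ : Set ℂ) : Prop :=
  (α₀ = α ∨ α₀ = -α) ∧
  ∃ γ : ℂ, γ ≠ 0 ∧
    (∃ δ ∈ (α + 1) • Λ₀ + (2 : ℂ) • Λ₀, β₀ = γ * β + δ) ∧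
    Λ₀ = γ • Λ

end

/-! Two facts about a cover `p` of type `S` with `0 ∈ Λ` carry the proof. First, covers of the same
type differ by an affine change of variable. Near every point of the plane a cover lifts through
another one of the same type: away from `S` by the charts, over a point of `S` because both maps are
squares in suitable coordinates. Continuation over growing discs makes a germ of a lift entire, and
lifting the other way gives an entire inverse, so the lift is affine (`exists_affine_of_germ`,
`exists_affine_of_entire_inverse`). Second, applied to `p` against itself this computes the deck
group: the slope is `±1`, every branch point is the centre of a half-turn, and half of every period
is a branch point. Hence `Λ` is a group and the fibres of `p` are the orbits of the maps `z ↦ ±z +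
2l`, `l ∈ Λ` (`eq_iff`).

If `f₀ = σ f σ⁻¹`, then `σ ∘ p` and `p₀` have the same type, so `p₀ (γ z + c) = σ • p z` for some `γ
≠ 0` and `c`. Branch points match, whence `c ∈ Λ₀` and `Λ₀ = γΛ`. Conjugating `α z + β` by `γ z + c`
gives a lift of `f₀` through `p₀`, which agrees with `α₀ z + β₀` up to a sign and an element of
`2Λ₀` (`affine_eq_of_comp_eq`). This is the relation between the coefficients; when the sign is
`-1`, `γ` is replaced by `-γ`.

Conversely, an affine map carrying `Λ` to `Λ₀` carries fibres of `p` to fibres of `p₀`, so it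
descends to a bijection of the sphere. After moving one value to `∞` this bijection is an entire map
with entire inverse, hence affine, hence the original one is a Möbius transformation
(`exists_moebius`). It conjugates `f` to the required `f₀`, and the freedom in the constant term of
the affine map accounts for `δ`. -/

open Filter Topology Metric

/-! ### Coordinates on the Riemann sphere. -/

/-- The point of the Riemann sphere with homogeneous coordinates `[x : y]`. -/
noncomputable def ofHomogeneous (x y : ℂ) : OnePoint ℂ :=
  if y = 0 then ∞ else ((x / y : ℂ) : OnePoint ℂ)

@[simp] lemma coordAt_coe_coe (a b : ℂ) : coordAt (a : OnePoint ℂ) (b : OnePoint ℂ) = b - a := rfl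
@[simp] lemma coordAt_coe_infty (a : ℂ) : coordAt (a : OnePoint ℂ) ∞ = 0 := rfl
@[simp] lemma coordAt_infty_coe (b : ℂ) : coordAt ∞ (b : OnePoint ℂ) = b⁻¹ := rfl
@[simp] lemma coordAt_infty_infty : coordAt ∞ ∞ = 0 := rfl
@[simp] lemma paramAt_coe (a t : ℂ) : paramAt (a : OnePoint ℂ) t = ((a + t : ℂ) : OnePoint ℂ) := rfl
lemma paramAt_infty (t : ℂ) :
    paramAt ∞ t = if t = 0 then ∞ else ((t⁻¹ : ℂ) : OnePoint ℂ) := rfl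

@[simp] lemma paramAt_zero (q : OnePoint ℂ) : paramAt q 0 = q := by
  induction q using OnePoint.rec <;> simp [paramAt_infty]

@[simp] lemma coordAt_self (q : OnePoint ℂ) : coordAt q q = 0 := by
  induction q using OnePoint.rec <;> simp

@[simp] lemma coordAt_paramAt (q : OnePoint ℂ) (t : ℂ) : coordAt q (paramAt q t) = t := by
  induction q using OnePoint.rec with
  | infty => by_cases h : t = 0 <;> simp [paramAt_infty, h]
  | coe a => simp

lemma paramAt_injective (q : OnePoint ℂ) : Function.Injective (paramAt q) :=
  Function.LeftInverse.injective (coordAt_paramAt q)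

lemma eventually_paramAt_coordAt (q : OnePoint ℂ) : ∀ᶠ w in 𝓝 q, paramAt q (coordAt q w) = w := by
  induction q using OnePoint.rec with
  | infty =>
    have : ∀ᶠ w : OnePoint ℂ in 𝓝 ∞, w ≠ ((0 : ℂ) : OnePoint ℂ) :=
      isOpen_ne.mem_nhds (OnePoint.infty_ne_coe _)
    filter_upwards [this] with w hw
    induction w using OnePoint.rec with
    | infty => simp
    | coe b =>
      have hb : b ≠ 0 := fun h => hw (by rw [h])
      simp [paramAt_infty, hb]
  | coe a =>
    have : ∀ᶠ w : OnePoint ℂ in 𝓝 (a : OnePoint ℂ), w ≠ ∞ :=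
      isOpen_ne.mem_nhds (OnePoint.coe_ne_infty _)
    filter_upwards [this] with w hw
    induction w using OnePoint.rec with
    | infty => exact absurd rfl hw
    | coe b => simp

lemma paramAt_infty_eq (t : ℂ) : paramAt ∞ t = ofHomogeneous 1 t := by
  simp [paramAt_infty, ofHomogeneous]

lemma paramAt_coe_eq (a t : ℂ) : paramAt a t = ofHomogeneous (a + t) 1 := by
  simp [ofHomogeneous]

lemma coe_eq_ofHomogeneous (a : ℂ) : (a : OnePoint ℂ) = ofHomogeneous a 1 := by
  simp [ofHomogeneous]

lemma infty_eq_ofHomogeneous : (∞ : OnePoint ℂ) = ofHomogeneous 1 0 := by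
  simp [ofHomogeneous]

lemma continuousAt_ofHomogeneous {X : Type*} [TopologicalSpace X] {A B : X → ℂ} {z : X}
    (hA : ContinuousAt A z) (hB : ContinuousAt B z) (h : A z ≠ 0 ∨ B z ≠ 0) :
    ContinuousAt (fun t => ofHomogeneous (A t) (B t)) z := by
  by_cases hz : B z = 0
  · have hAz : A z ≠ 0 := by tauto
    have hval : ofHomogeneous (A z) (B z) = ∞ := by simp [ofHomogeneous, hz]
    rw [ContinuousAt, hval, OnePoint.hasBasis_nhds_infty.tendsto_right_iff]
    rintro K ⟨-, hK⟩
    obtain ⟨M, hM⟩ := hK.isBounded.exists_norm_le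
    have h1 : ∀ᶠ t in 𝓝 z, ‖A z‖ / 2 < ‖A t‖ :=
      hA.norm.eventually (lt_mem_nhds (by simpa using hAz))
    have h2 : ∀ᶠ t in 𝓝 z, ‖B t‖ * (|M| + 1) < ‖A z‖ / 2 := by
      have : ContinuousAt (fun t => ‖B t‖ * (|M| + 1)) z := hB.norm.mul continuousAt_const
      exact this.eventually (gt_mem_nhds (by simpa [hz] using hAz))
    filter_upwards [h1, h2] with t ht1 ht2
    by_cases hBt : B t = 0
    · simp [ofHomogeneous, hBt]
    · left
      simp only [ofHomogeneous, hBt, if_false]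
      refine ⟨A t / B t, fun hmem => ?_, rfl⟩
      have := hM _ hmem
      rw [norm_div, div_le_iff₀ (by simpa using hBt)] at this
      have h3 : M * ‖B t‖ ≤ ‖B t‖ * (|M| + 1) := by
        nlinarith [norm_nonneg (B t), le_abs_self M]
      linarith
  · have h1 : ∀ᶠ t in 𝓝 z, B t ≠ 0 := hB.eventually_ne hz
    have h2 : (fun t => ofHomogeneous (A t) (B t)) =ᶠ[𝓝 z]
        fun t => ((A t / B t : ℂ) : OnePoint ℂ) := by
      filter_upwards [h1] with t ht
      simp [ofHomogeneous, ht]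
    exact (OnePoint.continuous_coe.continuousAt.comp (hA.div hB hz)).congr h2.symm

/-! ### Holomorphic maps from the plane to the sphere. -/

/-- A map from the plane to the sphere is holomorphic at `z`. -/
def HolomorphicToSphereAt (g : ℂ → OnePoint ℂ) (z : ℂ) : Prop :=
  ContinuousAt g z ∧ AnalyticAt ℂ (fun t => coordAt (g z) (g t)) z

lemma IsHolomorphicToSphere.at {g : ℂ → OnePoint ℂ} (h : IsHolomorphicToSphere g) (z : ℂ) :
    HolomorphicToSphereAt g z := ⟨h.1.continuousAt, h.2 z⟩

lemma isHolomorphicToSphere_iff {g : ℂ → OnePoint ℂ} :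
    IsHolomorphicToSphere g ↔ ∀ z, HolomorphicToSphereAt g z :=
  ⟨fun h => h.at, fun h => ⟨continuous_iff_continuousAt.2 fun z => (h z).1, fun z => (h z).2⟩⟩

lemma HolomorphicToSphereAt.eventually_eq {g : ℂ → OnePoint ℂ} {z : ℂ}
    (h : HolomorphicToSphereAt g z) : ∀ᶠ t in 𝓝 z, g t = paramAt (g z) (coordAt (g z) (g t)) :=
  (h.1.eventually (eventually_paramAt_coordAt (g z))).mono fun _ ht => ht.symm

lemma HolomorphicToSphereAt.congr {g g' : ℂ → OnePoint ℂ} {z : ℂ}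
    (h : HolomorphicToSphereAt g z) (he : g =ᶠ[𝓝 z] g') : HolomorphicToSphereAt g' z := by
  refine ⟨h.1.congr he, h.2.congr ?_⟩
  filter_upwards [he] with t ht
  rw [ht, he.self_of_nhds]

lemma localDegree_congr {g g' : ℂ → OnePoint ℂ} {z : ℂ} (he : g =ᶠ[𝓝 z] g') :
    localDegree g z = localDegree g' z := by
  refine analyticOrderAt_congr ?_
  filter_upwards [he] with t ht
  rw [ht, he.self_of_nhds]

lemma holomorphicToSphereAt_ofHomogeneous {A B : ℂ → ℂ} {z : ℂ} (hA : AnalyticAt ℂ A z)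
    (hB : AnalyticAt ℂ B z) (h : A z ≠ 0 ∨ B z ≠ 0) :
    HolomorphicToSphereAt (fun t => ofHomogeneous (A t) (B t)) z := by
  refine ⟨continuousAt_ofHomogeneous hA.continuousAt hB.continuousAt h, ?_⟩
  by_cases hz : B z = 0
  · have hAz : A z ≠ 0 := by tauto
    refine (hB.div hA hAz).congr ?_
    filter_upwards [hA.continuousAt.eventually_ne hAz] with t ht
    by_cases hBt : B t = 0 <;> simp [ofHomogeneous, hz, hBt]
  · refine ((hA.div hB hz).sub (analyticAt_const (v := A z / B z))).congr ?_
    filter_upwards [hB.continuousAt.eventually_ne hz] with t ht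
    simp [ofHomogeneous, hz, ht]

lemma holomorphicToSphereAt_paramAt (q : OnePoint ℂ) {F : ℂ → ℂ} {z : ℂ} (hF : AnalyticAt ℂ F z) :
    HolomorphicToSphereAt (fun t => paramAt q (F t)) z := by
  induction q using OnePoint.rec with
  | infty =>
    simp_rw [paramAt_infty_eq]
    exact holomorphicToSphereAt_ofHomogeneous analyticAt_const hF (by simp)
  | coe a =>
    simp_rw [paramAt_coe_eq]
    exact holomorphicToSphereAt_ofHomogeneous (analyticAt_const.add hF) analyticAt_const (by simp)

lemma HolomorphicToSphereAt.comp {g : ℂ → OnePoint ℂ} {h : ℂ → ℂ} {z : ℂ}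
    (hg : HolomorphicToSphereAt g (h z)) (hh : AnalyticAt ℂ h z) :
    HolomorphicToSphereAt (fun t => g (h t)) z :=
  ⟨ContinuousAt.comp (g := g) hg.1 hh.continuousAt,
    AnalyticAt.comp (g := fun t => coordAt (g (h z)) (g t)) hg.2 hh⟩

/-! ### Möbius transformations and local degree. -/

lemma smul_ofHomogeneous (σ : GL (Fin 2) ℂ) {x y : ℂ} (h : x ≠ 0 ∨ y ≠ 0) :
    σ • ofHomogeneous x y =
      ofHomogeneous (σ 0 0 * x + σ 0 1 * y) (σ 1 0 * x + σ 1 1 * y) := by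
  by_cases hy : y = 0
  · have hx : x ≠ 0 := by tauto
    by_cases hc : σ 1 0 = 0 <;>
      simp [ofHomogeneous, hy, OnePoint.smul_infty_eq_ite, hx, hc, mul_div_mul_right]
  · have e : σ 1 0 * (x / y) + σ 1 1 = (σ 1 0 * x + σ 1 1 * y) / y := by field_simp
    have e' : σ 0 0 * (x / y) + σ 0 1 = (σ 0 0 * x + σ 0 1 * y) / y := by field_simp
    simp only [ofHomogeneous, hy, if_false, OnePoint.smul_some_eq_ite, e, e', div_eq_zero_iff,
      or_false, div_div_div_cancel_right₀ hy]

lemma GL_apply_ne_zero (σ : GL (Fin 2) ℂ) {x y : ℂ} (h : x ≠ 0 ∨ y ≠ 0) :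
    σ 0 0 * x + σ 0 1 * y ≠ 0 ∨ σ 1 0 * x + σ 1 1 * y ≠ 0 := by
  by_contra! H
  have hdet : σ 0 0 * σ 1 1 - σ 0 1 * σ 1 0 ≠ 0 := by
    have := σ.det_ne_zero
    rwa [Matrix.det_fin_two] at this
  have hx : (σ 0 0 * σ 1 1 - σ 0 1 * σ 1 0) * x = 0 := by linear_combination σ 1 1 * H.1 - σ 0 1 * H.2
  have hy : (σ 0 0 * σ 1 1 - σ 0 1 * σ 1 0) * y = 0 := by linear_combination -σ 1 0 * H.1 + σ 0 0 * H.2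
  simp_all

/-- Near `z` the map is a ratio of two analytic functions without common zero; on such pairs `σ`
acts linearly, which avoids cases on which points are `∞`. -/
lemma HolomorphicToSphereAt.smul {g : ℂ → OnePoint ℂ} {z : ℂ} (σ : GL (Fin 2) ℂ)
    (hg : HolomorphicToSphereAt g z) : HolomorphicToSphereAt (fun t => σ • g t) z := by
  obtain ⟨A, B, hA, hB, hne, he⟩ : ∃ A B : ℂ → ℂ, AnalyticAt ℂ A z ∧ AnalyticAt ℂ B z ∧
      (∀ t, A t ≠ 0 ∨ B t ≠ 0) ∧ g =ᶠ[𝓝 z] fun t => ofHomogeneous (A t) (B t) := by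
    have h1 := hg.eventually_eq
    have h2 := hg.2
    generalize g z = q at h1 h2
    induction q using OnePoint.rec with
    | infty =>
      refine ⟨fun _ => 1, _, analyticAt_const, h2, by simp, ?_⟩
      filter_upwards [h1] with t ht
      rw [← paramAt_infty_eq]; exact ht
    | coe a =>
      refine ⟨fun t => a + coordAt a (g t), fun _ => 1, analyticAt_const.add h2, analyticAt_const,
        by simp, ?_⟩
      filter_upwards [h1] with t ht
      rw [← paramAt_coe_eq]; exact ht
  have hA' : AnalyticAt ℂ (fun t => σ 0 0 * A t + σ 0 1 * B t) z := by fun_prop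
  have hB' : AnalyticAt ℂ (fun t => σ 1 0 * A t + σ 1 1 * B t) z := by fun_prop
  refine (holomorphicToSphereAt_ofHomogeneous hA' hB' (GL_apply_ne_zero σ (hne z))).congr ?_
  filter_upwards [he] with t ht
  rw [ht, smul_ofHomogeneous σ (hne t)]

/-- A Möbius transformation read in the standard coordinates centred at `q` and at its image. -/
lemma exists_smul_paramAt (σ : GL (Fin 2) ℂ) (q : OnePoint ℂ) :
    ∃ m : ℂ → ℂ, AnalyticAt ℂ m 0 ∧ m 0 = 0 ∧ deriv m 0 ≠ 0 ∧
      ∀ᶠ t in 𝓝 (0 : ℂ), σ • paramAt q t = paramAt (σ • q) (m t) := by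
  have key : ∀ (σ : GL (Fin 2) ℂ) (q : OnePoint ℂ), ∃ m : ℂ → ℂ, AnalyticAt ℂ m 0 ∧ m 0 = 0 ∧
      ∀ᶠ t in 𝓝 (0 : ℂ), σ • paramAt q t = paramAt (σ • q) (m t) := fun σ q => by
    have h := (holomorphicToSphereAt_paramAt q (z := 0) analyticAt_id).smul σ
    refine ⟨_, h.2, by simp, ?_⟩
    simpa using h.eventually_eq
  obtain ⟨m, hm, hm0, hme⟩ := key σ q
  -- The local expression `n` of `σ⁻¹` inverts `m` near `0`, so the chain rule excludes a vanishing
  -- derivative.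
  obtain ⟨n, hn, hn0, hne⟩ := key σ⁻¹ (σ • q)
  refine ⟨m, hm, hm0, fun hd => ?_, hme⟩
  have hcomp : (fun t => n (m t)) =ᶠ[𝓝 0] fun t => t := by
    have hmt : Tendsto m (𝓝 0) (𝓝 0) := by simpa [hm0] using hm.continuousAt.tendsto
    filter_upwards [hme, hmt.eventually hne] with t h1 h2
    rw [← h1, inv_smul_smul, inv_smul_smul] at h2
    exact (paramAt_injective q h2).symm
  have h1 : deriv (fun t => n (m t)) 0 = 1 := by rw [hcomp.deriv_eq]; simp
  have h2 : HasDerivAt (fun t => n (m t)) (deriv n (m 0) * deriv m 0) 0 :=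
    HasDerivAt.comp (0 : ℂ) (by rw [hm0]; exact hn.differentiableAt.hasDerivAt)
      hm.differentiableAt.hasDerivAt
  rw [h2.deriv, hd] at h1
  simp at h1

lemma localDegree_smul (σ : GL (Fin 2) ℂ) {g : ℂ → OnePoint ℂ} {z : ℂ}
    (hg : HolomorphicToSphereAt g z) : localDegree (fun t => σ • g t) z = localDegree g z := by
  obtain ⟨m, hm, hm0, hmd, hme⟩ := exists_smul_paramAt σ (g z)
  have h0 : coordAt (g z) (g z) = 0 := by simp
  have hF : Tendsto (fun t => coordAt (g z) (g t)) (𝓝 z) (𝓝 0) := by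
    simpa using hg.2.continuousAt.tendsto
  have he : (fun t => coordAt (σ • g z) (σ • g t)) =ᶠ[𝓝 z] m ∘ fun t => coordAt (g z) (g t) := by
    filter_upwards [hg.eventually_eq, hF.eventually hme] with t h1 h2
    rw [← h1] at h2
    simp [h2]
  rw [localDegree, analyticOrderAt_congr he, AnalyticAt.analyticOrderAt_comp (by simpa using hm) hg.2]
  simp [localDegree, hm.analyticOrderAt_eq_one_of_zero_deriv_ne_zero hm0 hmd]

lemma localDegree_comp {g : ℂ → OnePoint ℂ} {h : ℂ → ℂ} {z : ℂ} (hh : AnalyticAt ℂ h z)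
    (hd : deriv h z ≠ 0) : localDegree (fun t => g (h t)) z = localDegree g (h z) :=
  analyticOrderAt_comp_of_deriv_ne_zero (f := fun t => coordAt (g (h z)) (g t)) hh hd

lemma sphereLocalDegree_conj (σ : GL (Fin 2) ℂ) (f : OnePoint ℂ → OnePoint ℂ) (q : OnePoint ℂ)
    (hf : ∀ q, HolomorphicToSphereAt (fun t => f (paramAt q t)) 0) :
    sphereLocalDegree (fun x => σ • f (σ⁻¹ • x)) q = sphereLocalDegree f (σ⁻¹ • q) := by
  obtain ⟨m, hm, hm0, hmd, hme⟩ := exists_smul_paramAt σ⁻¹ q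
  have he : (fun t => σ • f (σ⁻¹ • paramAt q t)) =ᶠ[𝓝 0]
      fun t => σ • f (paramAt (σ⁻¹ • q) (m t)) := by
    filter_upwards [hme] with t ht
    rw [ht]
  have hh : HolomorphicToSphereAt (fun t => f (paramAt (σ⁻¹ • q) (m t))) 0 :=
    HolomorphicToSphereAt.comp (g := fun t => f (paramAt (σ⁻¹ • q) t)) (by simpa [hm0] using hf _) hm
  rw [sphereLocalDegree, localDegree_congr he, localDegree_smul σ hh,
    localDegree_comp (g := fun t => f (paramAt (σ⁻¹ • q) t)) hm hmd, hm0, sphereLocalDegree]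

/-! ### Rational maps in homogeneous coordinates. -/

/-- The value at `(x, y)` of the homogenization of degree `n` of a polynomial. -/
noncomputable def homogeneousEval (P : ℂ[X]) (n : ℕ) (x y : ℂ) : ℂ :=
  ∑ i ∈ Finset.range (n + 1), P.coeff i * x ^ i * y ^ (n - i)

lemma homogeneousEval_of_ne {P : ℂ[X]} {n : ℕ} (h : P.natDegree ≤ n) (x : ℂ) {y : ℂ} (hy : y ≠ 0) :
    homogeneousEval P n x y = y ^ n * P.eval (x / y) := by
  rw [homogeneousEval, Polynomial.eval_eq_sum_range' (Nat.lt_succ_of_le h), Finset.mul_sum]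
  refine Finset.sum_congr rfl fun i hi => ?_
  have hi' : i ≤ n := Nat.lt_succ_iff.1 (Finset.mem_range.1 hi)
  have : y ^ n = y ^ (n - i) * y ^ i := by rw [← pow_add, Nat.sub_add_cancel hi']
  rw [this, div_pow]
  field_simp

lemma homogeneousEval_zero (P : ℂ[X]) (n : ℕ) (x : ℂ) :
    homogeneousEval P n x 0 = P.coeff n * x ^ n := by
  rw [homogeneousEval, Finset.sum_range_succ, Finset.sum_eq_zero]
  · simp
  · intro i hi
    have : n - i ≠ 0 := by have := Finset.mem_range.1 hi; omega
    simp [this]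

lemma ofHomogeneous_mul {c : ℂ} (hc : c ≠ 0) (x y : ℂ) :
    ofHomogeneous (c * x) (c * y) = ofHomogeneous x y := by
  by_cases hy : y = 0 <;> simp [ofHomogeneous, hy, hc, mul_div_mul_left]

/-- Homogeneous forms put `∞` on the same footing as the other points, so that composition with a
Möbius transformation on either side is a linear operation. Coprimality, together with the
normalization of the degree, becomes the absence of a common zero other than the origin. -/
lemma isRationalMap_iff {f : OnePoint ℂ → OnePoint ℂ} : IsRationalMap f ↔
    ∃ (n : ℕ) (P Q : ℂ[X]), P.natDegree ≤ n ∧ Q.natDegree ≤ n ∧ ∀ x y : ℂ, (x ≠ 0 ∨ y ≠ 0) →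
      (homogeneousEval P n x y ≠ 0 ∨ homogeneousEval Q n x y ≠ 0) ∧
      f (ofHomogeneous x y) = ofHomogeneous (homogeneousEval P n x y) (homogeneousEval Q n x y) := by
  constructor
  · rintro ⟨P, Q, hPQ, hf, hinf⟩
    refine ⟨_, P, Q, le_max_left _ _, le_max_right _ _, fun x y hxy => ?_⟩
    set n := max P.natDegree Q.natDegree with hn
    by_cases hy : y = 0
    · subst hy
      have hx : x ≠ 0 := by simpa using hxy
      have hxn : x ^ n ≠ 0 := pow_ne_zero _ hx
      -- If both vanished, the polynomial of degree `n` would be zero; then `n = 0`, and the other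
      -- one would be zero too, against coprimality.
      have hcoeff : P.coeff n ≠ 0 ∨ Q.coeff n ≠ 0 := by
        by_contra! H
        rcases max_choice P.natDegree Q.natDegree with h | h
        · have hP : P = 0 := by
            rw [← Polynomial.leadingCoeff_eq_zero, Polynomial.leadingCoeff, ← h]; exact H.1
          have hQ : Q.natDegree = 0 := by
            have := le_max_right P.natDegree Q.natDegree; rw [h, hP] at this; simpa using this
          rw [hP, isCoprime_zero_left] at hPQ
          apply hPQ.ne_zero
          rw [← Polynomial.leadingCoeff_eq_zero, Polynomial.leadingCoeff, hQ]
          have : n = 0 := by rw [hn, h, hP]; simp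
          rw [← this]; exact H.2
        · have hQ : Q = 0 := by
            rw [← Polynomial.leadingCoeff_eq_zero, Polynomial.leadingCoeff, ← h]; exact H.2
          have hP : P.natDegree = 0 := by
            have := le_max_left P.natDegree Q.natDegree; rw [h, hQ] at this; simpa using this
          rw [hQ, isCoprime_zero_right] at hPQ
          apply hPQ.ne_zero
          rw [← Polynomial.leadingCoeff_eq_zero, Polynomial.leadingCoeff, hP]
          have : n = 0 := by rw [hn, h, hQ]; simp
          rw [← this]; exact H.1
      rw [homogeneousEval_zero, homogeneousEval_zero]
      refine ⟨by simpa [hx] using hcoeff, ?_⟩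
      rw [mul_comm, mul_comm (Q.coeff n), ofHomogeneous_mul hxn]
      simpa [ofHomogeneous] using hinf
    · rw [homogeneousEval_of_ne (le_max_left _ _) x hy, homogeneousEval_of_ne (le_max_right _ _) x hy]
      have hyn : y ^ n ≠ 0 := pow_ne_zero _ hy
      refine ⟨?_, ?_⟩
      · by_contra! H
        obtain ⟨a, b, hab⟩ := hPQ
        have h1 := (mul_eq_zero.1 H.1).resolve_left hyn
        have h2 := (mul_eq_zero.1 H.2).resolve_left hyn
        have := congrArg (Polynomial.eval (x / y)) hab
        simp [h1, h2] at this
      · rw [ofHomogeneous_mul hyn]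
        simp only [ofHomogeneous, hy, if_false]
        exact hf _
  · rintro ⟨n, P, Q, hP, hQ, H⟩
    have hcop : IsCoprime P Q := by
      rw [Polynomial.isCoprime_iff_aeval_ne_zero_of_isAlgClosed ℂ ℂ]
      intro a
      have := (H a 1 (by simp)).1
      rw [homogeneousEval_of_ne hP a one_ne_zero, homogeneousEval_of_ne hQ a one_ne_zero] at this
      simpa using this
    have h1 := H 1 0 (by simp)
    rw [homogeneousEval_zero, homogeneousEval_zero] at h1
    simp only [one_pow, mul_one, ← infty_eq_ofHomogeneous] at h1
    have hmax : max P.natDegree Q.natDegree = n := by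
      refine le_antisymm (max_le hP hQ) ?_
      rcases h1.1 with h | h
      · exact le_max_of_le_left (Polynomial.le_natDegree_of_ne_zero h)
      · exact le_max_of_le_right (Polynomial.le_natDegree_of_ne_zero h)
    refine ⟨P, Q, hcop, fun z => ?_, ?_⟩
    · have := (H z 1 (by simp)).2
      rw [homogeneousEval_of_ne hP z one_ne_zero, homogeneousEval_of_ne hQ z one_ne_zero,
        ← coe_eq_ofHomogeneous] at this
      rw [this]
      simp [ofHomogeneous]
    · rw [hmax, h1.2]
      rfl

/-- The polynomial `∑ Pᵢ (aX + b)ⁱ (cX + d)ⁿ⁻ⁱ`. -/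
noncomputable def linearSubstitution (P : ℂ[X]) (n : ℕ) (a b c d : ℂ) : ℂ[X] :=
  ∑ i ∈ Finset.range (n + 1), Polynomial.C (P.coeff i) *
    (Polynomial.C a * Polynomial.X + Polynomial.C b) ^ i *
    (Polynomial.C c * Polynomial.X + Polynomial.C d) ^ (n - i)

lemma natDegree_linearSubstitution_summand_le (n i : ℕ) (hi : i ∈ Finset.range (n + 1)) (e a b c d : ℂ) :
    (Polynomial.C e * (Polynomial.C a * Polynomial.X + Polynomial.C b) ^ i *
    (Polynomial.C c * Polynomial.X + Polynomial.C d) ^ (n - i)).natDegree ≤ n := by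
  have h1 : ∀ (a b : ℂ) (k : ℕ),
      ((Polynomial.C a * Polynomial.X + Polynomial.C b) ^ k).natDegree ≤ k := fun a b k =>
    Polynomial.natDegree_pow_le.trans
      ((Nat.mul_le_mul_left k (Polynomial.natDegree_linear_le (a := a) (b := b))).trans (by simp))
  have hi' : i ≤ n := Nat.lt_succ_iff.1 (Finset.mem_range.1 hi)
  refine Polynomial.natDegree_mul_le.trans ?_
  have := Polynomial.natDegree_C_mul_le e ((Polynomial.C a * Polynomial.X + Polynomial.C b) ^ i)
  have := h1 a b i
  have := h1 c d (n - i)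
  omega

lemma natDegree_linearSubstitution_le (P : ℂ[X]) (n : ℕ) (a b c d : ℂ) :
    (linearSubstitution P n a b c d).natDegree ≤ n :=
  Polynomial.natDegree_sum_le_of_forall_le _ _ fun i hi =>
    natDegree_linearSubstitution_summand_le n i hi _ a b c d

lemma homogeneousEval_linearSubstitution (P : ℂ[X]) (n : ℕ) (a b c d x y : ℂ) :
    homogeneousEval (linearSubstitution P n a b c d) n x y =
      homogeneousEval P n (a * x + b * y) (c * x + d * y) := by
  by_cases hy : y = 0
  -- At `y = 0` only the coefficient of degree `n` survives, and each summand contributes the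
  -- product of the top coefficients of its two factors.
  · subst hy
    rw [homogeneousEval_zero, linearSubstitution, Polynomial.finsetSum_coeff, Finset.sum_mul,
      homogeneousEval]
    refine Finset.sum_congr rfl fun i hi => ?_
    have hi' : i ≤ n := Nat.lt_succ_iff.1 (Finset.mem_range.1 hi)
    have hc : ∀ (a b : ℂ) (k : ℕ),
        ((Polynomial.C a * Polynomial.X + Polynomial.C b) ^ k).coeff k = a ^ k := fun a b k => by
      have := Polynomial.coeff_pow_of_natDegree_le (m := k) (Polynomial.natDegree_linear_le (a := a) (b := b))
      simpa using this
    have hd : ∀ (a b : ℂ) (k : ℕ),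
        ((Polynomial.C a * Polynomial.X + Polynomial.C b) ^ k).natDegree ≤ k := fun a b k =>
      Polynomial.natDegree_pow_le.trans
        ((Nat.mul_le_mul_left k (Polynomial.natDegree_linear_le (a := a) (b := b))).trans (by simp))
    have h2 := Polynomial.coeff_mul_add_eq_of_natDegree_le (hd a b i) (hd c d (n - i))
    rw [Nat.add_sub_cancel' hi', hc, hc] at h2
    rw [mul_assoc, Polynomial.coeff_C_mul, h2]
    have : x ^ n = x ^ i * x ^ (n - i) := by rw [← pow_add, Nat.add_sub_cancel' hi']
    rw [this, mul_zero, mul_zero, add_zero, add_zero, mul_pow, mul_pow]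
    ring
  · rw [homogeneousEval_of_ne (natDegree_linearSubstitution_le P n a b c d) x hy, linearSubstitution,
      Polynomial.eval_finsetSum, Finset.mul_sum, homogeneousEval]
    refine Finset.sum_congr rfl fun i hi => ?_
    have hi' : i ≤ n := Nat.lt_succ_iff.1 (Finset.mem_range.1 hi)
    have e1 : a * x + b * y = y * (a * (x / y) + b) := by field_simp
    have e2 : c * x + d * y = y * (c * (x / y) + d) := by field_simp
    have : y ^ n = y ^ i * y ^ (n - i) := by rw [← pow_add, Nat.add_sub_cancel' hi']
    rw [this, e1, e2, mul_pow, mul_pow]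
    simp
    ring

lemma homogeneousEval_combination (P Q : ℂ[X]) (n : ℕ) (a b x y : ℂ) :
    homogeneousEval (Polynomial.C a * P + Polynomial.C b * Q) n x y =
      a * homogeneousEval P n x y + b * homogeneousEval Q n x y := by
  simp only [homogeneousEval, Finset.mul_sum, ← Finset.sum_add_distrib]
  refine Finset.sum_congr rfl fun i _ => ?_
  simp
  ring

lemma IsRationalMap.smul_left {f : OnePoint ℂ → OnePoint ℂ} (hf : IsRationalMap f)
    (σ : GL (Fin 2) ℂ) : IsRationalMap fun q => σ • f q := by
  rw [isRationalMap_iff] at hf ⊢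
  obtain ⟨n, P, Q, hP, hQ, H⟩ := hf
  have hdeg : ∀ a b : ℂ, (Polynomial.C a * P + Polynomial.C b * Q).natDegree ≤ n := fun a b =>
    (Polynomial.natDegree_add_le _ _).trans (max_le ((Polynomial.natDegree_C_mul_le _ _).trans hP)
      ((Polynomial.natDegree_C_mul_le _ _).trans hQ))
  refine ⟨n, Polynomial.C (σ 0 0) * P + Polynomial.C (σ 0 1) * Q,
    Polynomial.C (σ 1 0) * P + Polynomial.C (σ 1 1) * Q, hdeg _ _, hdeg _ _, fun x y hxy => ?_⟩
  rw [homogeneousEval_combination, homogeneousEval_combination, (H x y hxy).2]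
  exact ⟨GL_apply_ne_zero σ (H x y hxy).1, smul_ofHomogeneous σ (H x y hxy).1⟩

lemma IsRationalMap.comp_smul {f : OnePoint ℂ → OnePoint ℂ} (hf : IsRationalMap f)
    (σ : GL (Fin 2) ℂ) : IsRationalMap fun q => f (σ • q) := by
  rw [isRationalMap_iff] at hf ⊢
  obtain ⟨n, P, Q, hP, hQ, H⟩ := hf
  refine ⟨n, linearSubstitution P n (σ 0 0) (σ 0 1) (σ 1 0) (σ 1 1),
    linearSubstitution Q n (σ 0 0) (σ 0 1) (σ 1 0) (σ 1 1), natDegree_linearSubstitution_le ..,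
    natDegree_linearSubstitution_le .., fun x y hxy => ?_⟩
  simp only [homogeneousEval_linearSubstitution, smul_ofHomogeneous σ hxy]
  exact H _ _ (GL_apply_ne_zero σ hxy)

lemma analyticAt_homogeneousEval (P : ℂ[X]) (n : ℕ) {A B : ℂ → ℂ} {z : ℂ} (hA : AnalyticAt ℂ A z)
    (hB : AnalyticAt ℂ B z) : AnalyticAt ℂ (fun t => homogeneousEval P n (A t) (B t)) z := by
  unfold homogeneousEval
  fun_prop

lemma IsRationalMap.holomorphicToSphereAt {f : OnePoint ℂ → OnePoint ℂ} (hf : IsRationalMap f)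
    (q : OnePoint ℂ) : HolomorphicToSphereAt (fun t => f (paramAt q t)) 0 := by
  obtain ⟨n, P, Q, hP, hQ, H⟩ := isRationalMap_iff.1 hf
  have key : ∀ A B : ℂ → ℂ, AnalyticAt ℂ A 0 → AnalyticAt ℂ B 0 → (∀ t, A t ≠ 0 ∨ B t ≠ 0) →
      HolomorphicToSphereAt (fun t => f (ofHomogeneous (A t) (B t))) 0 := fun A B hA hB h => by
    simp_rw [fun t => (H _ _ (h t)).2]
    exact holomorphicToSphereAt_ofHomogeneous (analyticAt_homogeneousEval P n hA hB)
      (analyticAt_homogeneousEval Q n hA hB) (H _ _ (h 0)).1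
  induction q using OnePoint.rec with
  | infty =>
    simp_rw [paramAt_infty_eq]
    exact key _ _ analyticAt_const analyticAt_id (by simp)
  | coe a =>
    simp_rw [paramAt_coe_eq]
    exact key _ _ (by fun_prop) analyticAt_const (by simp)

/-! ### Conjugates of Lattès maps. -/

lemma criticalPoints_conj (σ : GL (Fin 2) ℂ) {f : OnePoint ℂ → OnePoint ℂ} (hf : IsRationalMap f) :
    criticalPoints (fun x => σ • f (σ⁻¹ • x)) = {q | σ⁻¹ • q ∈ criticalPoints f} := by
  ext q
  simp only [criticalPoints, Set.mem_ofPred_eq,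
    sphereLocalDegree_conj σ f q hf.holomorphicToSphereAt]

lemma iterate_conj (σ : GL (Fin 2) ℂ) (f : OnePoint ℂ → OnePoint ℂ) (n : ℕ) (q : OnePoint ℂ) :
    (fun x => σ • f (σ⁻¹ • x))^[n] q = σ • f^[n] (σ⁻¹ • q) := by
  induction n with
  | zero => simp
  | succ n ih => rw [Function.iterate_succ_apply', ih, Function.iterate_succ_apply', inv_smul_smul]

lemma postcriticalSet_conj (σ : GL (Fin 2) ℂ) {f : OnePoint ℂ → OnePoint ℂ} (hf : IsRationalMap f) :
    postcriticalSet (fun x => σ • f (σ⁻¹ • x)) = σ • postcriticalSet f := by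
  ext q
  rw [Set.mem_smul_set_iff_inv_smul_mem]
  simp only [postcriticalSet, criticalPoints_conj σ hf, iterate_conj, Set.mem_ofPred_eq]
  constructor
  · rintro ⟨c, hc, n, hn, rfl⟩
    exact ⟨_, hc, n, hn, by rw [inv_smul_smul]⟩
  · rintro ⟨c, hc, n, hn, h⟩
    exact ⟨σ • c, by rwa [inv_smul_smul], n, hn, by rw [inv_smul_smul, h, smul_inv_smul]⟩

lemma IsLattes.conj {f : OnePoint ℂ → OnePoint ℂ} (hf : IsLattes f) (σ : GL (Fin 2) ℂ) :
    IsLattes fun x => σ • f (σ⁻¹ • x) where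
  rational := (hf.rational.comp_smul σ⁻¹).smul_left σ
  simple c hc := by
    rw [criticalPoints_conj σ hf.rational] at hc
    rw [sphereLocalDegree_conj σ f c hf.rational.holomorphicToSphereAt]
    exact hf.simple _ hc
  four := by
    rw [postcriticalSet_conj σ hf.rational, Set.ncard_smul_set]
    exact hf.four
  not_critical q hq := by
    rw [postcriticalSet_conj σ hf.rational, Set.mem_smul_set_iff_inv_smul_mem] at hq
    rw [criticalPoints_conj σ hf.rational]
    exact hf.not_critical _ hq

/-! ### Local normal forms. -/

lemma exists_analytic_localInverse {k : ℂ → ℂ} {c : ℂ} (hk : AnalyticAt ℂ k c)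
    (hd : deriv k c ≠ 0) : ∃ s : ℂ → ℂ, AnalyticAt ℂ s (k c) ∧ s (k c) = c ∧
      (∀ᶠ u in 𝓝 (k c), k (s u) = u) ∧ ∀ᶠ t in 𝓝 c, s (k t) = t := by
  let e : ℂ ≃L[ℂ] ℂ := ContinuousLinearEquiv.unitsEquivAut ℂ (Units.mk0 _ hd)
  have he : HasStrictFDerivAt k (e : ℂ →L[ℂ] ℂ) c := hk.hasStrictDerivAt.hasStrictFDerivAt_equiv hd
  refine ⟨he.localInverse, ?_, he.localInverse_apply_image, he.eventually_right_inverse,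
    he.eventually_left_inverse⟩
  exact ((he.toOpenPartialHomeomorph k).analyticAt_symm' he.mem_toOpenPartialHomeomorph_source hk
    he.hasFDerivAt.fderiv)

lemma exists_analytic_pow_eq {g : ℂ → ℂ} {c : ℂ} (hg : AnalyticAt ℂ g c) (h0 : g c ≠ 0) {n : ℕ}
    (hn : n ≠ 0) : ∃ r : ℂ → ℂ, AnalyticAt ℂ r c ∧ r c ≠ 0 ∧ ∀ᶠ t in 𝓝 c, r t ^ n = g t := by
  obtain ⟨b, hb⟩ := IsAlgClosed.exists_pow_nat_eq (g c) (Nat.pos_of_ne_zero hn)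
  have hb0 : b ≠ 0 := by rintro rfl; rw [zero_pow hn] at hb; exact h0 hb.symm
  -- Dividing by `g c` moves the value at `c` to `1`, where the principal logarithm is analytic; the
  -- factor `b` restores the constant.
  have h1 : g c / g c ∈ Complex.slitPlane := by rw [div_self h0]; exact Complex.one_mem_slitPlane
  refine ⟨fun t => b * Complex.exp (Complex.log (g t / g c) / n), ?_, ?_, ?_⟩
  · exact analyticAt_const.mul (((hg.div analyticAt_const h0).clog h1).div_const).cexp
  · exact mul_ne_zero hb0 (Complex.exp_ne_zero _)
  · filter_upwards [hg.continuousAt.eventually_ne h0] with t ht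
    have hn' : (n : ℂ) ≠ 0 := by exact_mod_cast hn
    rw [mul_pow, ← Complex.exp_nat_mul, mul_div_cancel₀ _ hn', Complex.exp_log (div_ne_zero ht h0), hb]
    field_simp

/-- The normal form of a holomorphic map near a point of local degree `n`: there are coordinates
`k` with local inverse `s` in which it is `u ↦ u ^ n`. -/
lemma exists_normalForm {g : ℂ → OnePoint ℂ} {c : ℂ} (hg : HolomorphicToSphereAt g c) {n : ℕ}
    (hn : n ≠ 0) (hdeg : localDegree g c = n) : ∃ k s : ℂ → ℂ,
      AnalyticAt ℂ k c ∧ k c = 0 ∧ AnalyticAt ℂ s 0 ∧ s 0 = c ∧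
      (∀ᶠ t in 𝓝 c, g t = paramAt (g c) (k t ^ n)) ∧
      (∀ᶠ u in 𝓝 0, g (s u) = paramAt (g c) (u ^ n)) ∧
      (∀ᶠ u in 𝓝 0, k (s u) = u) ∧ ∀ᶠ t in 𝓝 c, s (k t) = t := by
  obtain ⟨F, hF, hF0, hFe⟩ := (hg.2.analyticOrderAt_eq_natCast).1 hdeg
  obtain ⟨r, hr, hr0, hre⟩ := exists_analytic_pow_eq hF hF0 hn
  have hk : AnalyticAt ℂ (fun t => (t - c) * r t) c := by fun_prop
  have hkd : HasDerivAt (fun t => (t - c) * r t) (r c) c := by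
    have := ((hasDerivAt_id c).sub_const c).mul hr.differentiableAt.hasDerivAt
    convert! this using 1
    simp
  have hkc : (fun t => (t - c) * r t) c = 0 := by simp
  obtain ⟨s, hs, hsc, h1, h2⟩ := exists_analytic_localInverse hk (by rw [hkd.deriv]; exact hr0)
  simp only [sub_self, zero_mul] at hs hsc h1
  have h3 : ∀ᶠ t in 𝓝 c, g t = paramAt (g c) (((t - c) * r t) ^ n) := by
    filter_upwards [hg.eventually_eq, hFe, hre] with t a b d
    rw [a, b, mul_pow, d, smul_eq_mul]
  refine ⟨_, s, hk, by simp, hs, hsc, h3, ?_, h1, h2⟩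
  have hst : Tendsto s (𝓝 0) (𝓝 c) := by simpa [hsc] using hs.continuousAt.tendsto
  filter_upwards [hst.eventually h3, h1] with u a b
  rw [a, b]

lemma exists_injOn_of_localDegree_eq_one {g : ℂ → OnePoint ℂ} {c : ℂ}
    (hg : HolomorphicToSphereAt g c) (hdeg : localDegree g c = 1) : ∃ V ∈ 𝓝 c, Set.InjOn g V := by
  obtain ⟨k, s, -, -, -, -, h1, -, -, h2⟩ := exists_normalForm hg one_ne_zero (by simpa using hdeg)
  refine ⟨_, h1.and h2, fun a ha b hb hab => ?_⟩
  rw [ha.1, hb.1] at hab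
  have := paramAt_injective _ hab
  simp only [pow_one] at this
  rw [← ha.2, ← hb.2, this]

lemma eventually_ne_of_localDegree {g : ℂ → OnePoint ℂ} {c : ℂ} (hg : HolomorphicToSphereAt g c)
    {n : ℕ} (hn : n ≠ 0) (hdeg : localDegree g c = n) : ∀ᶠ t in 𝓝[≠] c, g t ≠ g c := by
  obtain ⟨k, s, -, hk0, -, hs, h1, -, -, h2⟩ := exists_normalForm hg hn hdeg
  filter_upwards [nhdsWithin_le_nhds h1, nhdsWithin_le_nhds h2, self_mem_nhdsWithin] with t a b htc h
  rw [a] at h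
  have : k t ^ n = 0 := paramAt_injective (g c) (by rw [h, paramAt_zero])
  rw [pow_eq_zero_iff hn] at this
  rw [this, hs] at b
  exact htc b.symm

/-- If a map of local degree `n` identifies the `k`-th roots of unity, up to a local
homeomorphism, then `k ≤ n`. -/
lemma le_localDegree_of_pow_eq {g : ℂ → OnePoint ℂ} {c : ℂ} (hg : HolomorphicToSphereAt g c)
    {n : ℕ} (hn : n ≠ 0) (hdeg : localDegree g c = n) {e : ℂ → ℂ} {k : ℕ} (hk : k ≠ 0)
    (he : ContinuousAt e 0) (he0 : e 0 = c) (hinj : Set.InjOn e (ball 0 1))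
    (hge : ∀ u ∈ ball (0 : ℂ) 1, ∀ v ∈ ball (0 : ℂ) 1, u ^ k = v ^ k → g (e u) = g (e v)) :
    k ≤ n := by
  classical
  obtain ⟨κ, s, -, -, -, -, h1, -, -, h2⟩ := exists_normalForm hg hn hdeg
  have h3 : ∀ᶠ u in 𝓝 (0 : ℂ), (g (e u) = paramAt (g c) (κ (e u) ^ n) ∧ s (κ (e u)) = e u) ∧
      u ∈ ball (0 : ℂ) 1 :=
    ((he.tendsto.eventually (by rw [he0]; exact h1.and h2))).and (ball_mem_nhds _ one_pos)
  obtain ⟨ε, hε, hball⟩ := Metric.eventually_nhds_iff_ball.1 h3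
  set a : ℂ := ((ε / 2 : ℝ) : ℂ) with ha
  have ha0 : a ≠ 0 := by rw [ha]; exact_mod_cast (half_pos hε).ne'
  have hprim := Complex.isPrimitiveRoot_exp k hk
  have hcard := hprim.card_nthRootsFinset
  have hmem : ∀ ζ ∈ Polynomial.nthRootsFinset k (1 : ℂ), a * ζ ∈ ball (0 : ℂ) ε ∧ ζ ^ k = 1 := by
    intro ζ hζ
    have hζ' : ζ ^ k = 1 := (Polynomial.mem_nthRootsFinset (Nat.pos_of_ne_zero hk) 1).1 hζ
    refine ⟨?_, hζ'⟩
    rw [mem_ball_zero_iff, norm_mul, Complex.norm_eq_one_of_pow_eq_one hζ' hk, ha, Complex.norm_real,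
      Real.norm_of_nonneg (half_pos hε).le]
    linarith
  have h1mem : (1 : ℂ) ∈ Polynomial.nthRootsFinset k (1 : ℂ) :=
    (Polynomial.mem_nthRootsFinset (Nat.pos_of_ne_zero hk) 1).2 (one_pow k)
  rw [← hcard]
  -- The `k` points `e (a ζ)` are distinct and have the same image under `g`, so the normal form
  -- turns them into `k` distinct `n`-th roots of one number.
  refine (Finset.card_le_card_of_injOn (fun ζ => κ (e (a * ζ)))
    (t := (Polynomial.nthRoots n (κ (e (a * 1)) ^ n)).toFinset) ?_ ?_).trans
    ((Multiset.toFinset_card_le _).trans (Polynomial.card_nthRoots _ _))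
  · intro ζ hζ
    rw [Finset.mem_coe] at hζ
    rw [Finset.mem_coe, Multiset.mem_toFinset, Polynomial.mem_nthRoots (Nat.pos_of_ne_zero hn)]
    obtain ⟨b1, b2⟩ := hball _ (hmem ζ hζ).1
    obtain ⟨d1, d2⟩ := hball _ (hmem 1 h1mem).1
    refine paramAt_injective (g c) ?_
    rw [← b1.1, ← d1.1]
    exact hge _ b2 _ d2 (by rw [mul_pow, mul_pow, (hmem ζ hζ).2, one_pow])
  · intro ζ hζ ξ hξ h
    obtain ⟨b1, b2⟩ := hball _ (hmem ζ hζ).1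
    obtain ⟨d1, d2⟩ := hball _ (hmem ξ hξ).1
    have : e (a * ζ) = e (a * ξ) := by
      rw [← b1.2, ← d1.2]
      exact congrArg s h
    exact mul_left_cancel₀ ha0 (hinj b2 d2 this)

/-! ### Lifts and their continuation. -/

/-- Where `q` has degree one it has an analytic local inverse, and a continuous lift must be that
inverse applied to `P`. This is needed because the charts of a branched cover are only
homeomorphisms. -/
lemma analyticAt_of_continuous_lift {q P : ℂ → OnePoint ℂ} {h : ℂ → ℂ} {z : ℂ}
    (hq : HolomorphicToSphereAt q (h z)) (hdeg : localDegree q (h z) = 1)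
    (hP : HolomorphicToSphereAt P z) (hh : ContinuousAt h z) (hlift : ∀ᶠ t in 𝓝 z, q (h t) = P t) :
    AnalyticAt ℂ h z := by
  obtain ⟨k, s, -, hk0, hs, -, h1, -, -, h2⟩ := exists_normalForm hq one_ne_zero (by simpa using hdeg)
  have hz : q (h z) = P z := hlift.self_of_nhds
  have key : (fun t => s (coordAt (P z) (P t))) =ᶠ[𝓝 z] h := by
    filter_upwards [hh.eventually h1, hh.eventually h2, hlift] with t a b d
    rw [← d, ← hz, a, pow_one, coordAt_paramAt, b]
  refine AnalyticAt.congr ?_ key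
  exact AnalyticAt.comp (g := s) (by simpa using hs) hP.2

/-- Local injectivity of `q` is used at the single point `v`, to identify the germs there; the
identity theorem does the rest. So the lifts may pass through branch points elsewhere. -/
lemma eqOn_of_lifts {q P : ℂ → OnePoint ℂ} {D : Set ℂ} (hD : IsPreconnected D)
    (hDo : IsOpen D) {h₁ h₂ : ℂ → ℂ} (a₁ : AnalyticOnNhd ℂ h₁ D) (a₂ : AnalyticOnNhd ℂ h₂ D)
    (l₁ : ∀ t ∈ D, q (h₁ t) = P t) (l₂ : ∀ t ∈ D, q (h₂ t) = P t) {v : ℂ} (hv : v ∈ D)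
    (hq : HolomorphicToSphereAt q (h₁ v)) (hdeg : localDegree q (h₁ v) = 1) (he : h₁ v = h₂ v) :
    Set.EqOn h₁ h₂ D := by
  refine a₁.eqOn_of_preconnected_of_eventuallyEq a₂ hD hv ?_
  obtain ⟨V, hV, hinj⟩ := exists_injOn_of_localDegree_eq_one hq hdeg
  filter_upwards [hDo.mem_nhds hv, (a₁ v hv).continuousAt hV,
    (a₂ v hv).continuousAt (by rwa [← he])] with t ht t1 t2
  exact hinj t1 t2 (by rw [l₁ t ht, l₂ t ht])

/-- `h` is an analytic lift of `P` through `q` on `D`. -/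
structure IsLiftOn (q P : ℂ → OnePoint ℂ) (h : ℂ → ℂ) (D : Set ℂ) : Prop where
  analytic : AnalyticOnNhd ℂ h D
  lift : ∀ t ∈ D, q (h t) = P t

lemma IsLiftOn.mono {q P : ℂ → OnePoint ℂ} {h : ℂ → ℂ} {D D' : Set ℂ} (hl : IsLiftOn q P h D)
    (hD : D' ⊆ D) : IsLiftOn q P h D' :=
  ⟨hl.analytic.mono hD, fun t ht => hl.lift t (hD ht)⟩

/-- Through every pair of points with the same image there is a lift on the ball. -/
def LiftsOn (q P : ℂ → OnePoint ℂ) (z : ℂ) (r : ℝ) : Prop :=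
  ∀ v ∈ ball z r, ∀ w, q w = P v → ∃ h, IsLiftOn q P h (ball z r) ∧ h v = w

lemma LiftsOn.mono {q P : ℂ → OnePoint ℂ} {z z' : ℂ} {r r' : ℝ} (h : LiftsOn q P z r)
    (hb : ball z' r' ⊆ ball z r) : LiftsOn q P z' r' := fun v hv w hw =>
  let ⟨k, hk, hkv⟩ := h v (hb hv) w hw
  ⟨k, hk.mono hb, hkv⟩

/-- `q` has local degree one over the complement of the nowhere dense preimage of `S`. -/
structure IsLiftingSetup (q P : ℂ → OnePoint ℂ) (S : Set (OnePoint ℂ)) : Prop where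
  holomorphic : IsHolomorphicToSphere q
  degree : ∀ z, q z ∉ S → localDegree q z = 1
  dense : Dense {t | P t ∉ S}

lemma IsLiftingSetup.eqOn {q P : ℂ → OnePoint ℂ} {S : Set (OnePoint ℂ)} (hs : IsLiftingSetup q P S)
    {D : Set ℂ} (hD : IsPreconnected D) (hDo : IsOpen D) {h₁ h₂ : ℂ → ℂ} (l₁ : IsLiftOn q P h₁ D)
    (l₂ : IsLiftOn q P h₂ D) {v : ℂ} (hv : v ∈ D) (hvS : P v ∉ S) (he : h₁ v = h₂ v) :
    Set.EqOn h₁ h₂ D :=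
  eqOn_of_lifts hD hDo l₁.analytic l₂.analytic l₁.lift l₂.lift hv (hs.holomorphic.at _)
    (hs.degree _ (by rwa [l₁.lift v hv])) he

/-- One step of the continuation: local lifts of a uniform radius, centred on the boundary circle,
are glued to `h` along the radii. -/
lemma IsLiftingSetup.extend {q P : ℂ → OnePoint ℂ} {S : Set (OnePoint ℂ)}
    (hs : IsLiftingSetup q P S) {z₀ : ℂ} {r δ : ℝ} (hr : 0 < r) (hδ : 0 < δ) {h : ℂ → ℂ}
    (hl : IsLiftOn q P h (ball z₀ r)) (hloc : ∀ z ∈ sphere z₀ r, LiftsOn q P z δ) :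
    ∃ H, IsLiftOn q P H (ball z₀ (r + δ / 4)) ∧ Set.EqOn h H (ball z₀ r) := by
  classical
  have hmeet : ∀ z ∈ sphere z₀ r, ∀ U : Set ℂ, IsOpen U → z ∈ U → (U ∩ ball z₀ r).Nonempty := by
    intro z hz U hU hzU
    have : z ∈ closure (ball z₀ r) := by
      rw [closure_ball z₀ hr.ne']; exact sphere_subset_closedBall hz
    exact mem_closure_iff.1 this U hU hzU
  have hex : ∀ z ∈ sphere z₀ r, ∃ k, IsLiftOn q P k (ball z δ) ∧
      Set.EqOn h k (ball z δ ∩ ball z₀ r) := by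
    intro z hz
    obtain ⟨v, ⟨hv1, hv2⟩, hvS⟩ := hs.dense.inter_open_nonempty _ (isOpen_ball.inter isOpen_ball)
      (hmeet z hz (ball z δ) isOpen_ball (mem_ball_self hδ))
    obtain ⟨k, hk, hkv⟩ := hloc z hz v hv1 (h v) (hl.lift v hv2)
    exact ⟨k, hk, hs.eqOn ((convex_ball z δ).inter (convex_ball z₀ r)).isPreconnected
      (isOpen_ball.inter isOpen_ball) (hl.mono Set.inter_subset_right) (hk.mono Set.inter_subset_left)
      ⟨hv1, hv2⟩ hvS hkv.symm⟩
  choose! k hk hkh using hex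
  -- The radial projection to the boundary circle selects the local lift to be used at `z`.
  let pr : ℂ → ℂ := fun z => z₀ + (r / ‖z - z₀‖ : ℝ) * (z - z₀)
  have hpr : ∀ z, r ≤ ‖z - z₀‖ → pr z ∈ sphere z₀ r ∧ dist z (pr z) = ‖z - z₀‖ - r := by
    intro z hz
    have hpos : 0 < ‖z - z₀‖ := hr.trans_le hz
    constructor
    · rw [mem_sphere_iff_norm]
      simp only [pr, add_sub_cancel_left, norm_mul, Complex.norm_real, norm_div, norm_norm]
      rw [Real.norm_of_nonneg hr.le, div_mul_cancel₀ _ hpos.ne']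
    · have : z - pr z = ((1 - r / ‖z - z₀‖ : ℝ) : ℂ) * (z - z₀) := by
        simp only [pr]; push_cast; ring
      rw [dist_eq_norm, this, norm_mul, Complex.norm_real, Real.norm_of_nonneg, sub_mul, one_mul,
        div_mul_cancel₀ _ hpos.ne']
      rw [sub_nonneg, div_le_one hpos]; exact hz
  let H : ℂ → ℂ := fun z => if z ∈ ball z₀ r then h z else k (pr z) z
  have hHin : ∀ z ∈ ball z₀ r, H z = h z := fun z hz => if_pos hz
  have hHout : ∀ z, z ∉ ball z₀ r → H z = k (pr z) z := fun z hz => if_neg hz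
  have hnot : ∀ z, z ∉ ball z₀ r → r ≤ ‖z - z₀‖ := fun z hz => by
    rw [mem_ball_iff_norm, not_lt] at hz; exact hz
  have hnear : ∀ z ∈ ball z₀ (r + δ / 4), z ∉ ball z₀ r → H =ᶠ[𝓝 z] k (pr z) := by
    intro z hz hzr
    obtain ⟨hp1, hp2⟩ := hpr z (hnot z hzr)
    rw [mem_ball_iff_norm] at hz
    have hz' : dist z (pr z) < δ / 4 := by rw [hp2]; linarith
    filter_upwards [ball_mem_nhds z (show 0 < δ / 4 by linarith)] with t ht
    rw [mem_ball] at ht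
    have htz : t ∈ ball (pr z) δ := by
      rw [mem_ball]; linarith [dist_triangle t z (pr z)]
    by_cases htr : t ∈ ball z₀ r
    · rw [hHin t htr]; exact hkh _ hp1 ⟨htz, htr⟩
    · rw [hHout t htr]
      obtain ⟨ht1, ht2⟩ := hpr t (hnot t htr)
      have htn : ‖t - z₀‖ ≤ ‖z - z₀‖ + dist t z := by
        rw [← dist_eq_norm, ← dist_eq_norm]; linarith [dist_triangle t z z₀]
      -- The three legs are less than `δ/4`, `δ/4` and `δ/2`, which is why the radius grows by `δ/4`
      -- only. The two discs of radius `δ` then overlap inside the original disc, where both local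
      -- lifts equal `h`.
      have hzt : dist (pr z) (pr t) < δ := by
        have := dist_triangle4 (pr z) z t (pr t)
        rw [dist_comm (pr z) z, dist_comm z t] at this
        linarith
      have htt : t ∈ ball (pr t) δ := by rw [mem_ball]; linarith
      obtain ⟨w, ⟨hw1, hw2⟩, hw3⟩ := hmeet _ hp1 (ball (pr t) δ ∩ ball (pr z) δ)
        (isOpen_ball.inter isOpen_ball) ⟨hzt, mem_ball_self hδ⟩
      refine ((hk _ ht1).analytic.mono Set.inter_subset_left).eqOn_of_preconnected_of_eventuallyEq
        ((hk _ hp1).analytic.mono Set.inter_subset_right)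
        ((convex_ball (pr t) δ).inter (convex_ball (pr z) δ)).isPreconnected ⟨hw1, hw2⟩ ?_ ⟨htt, htz⟩
      filter_upwards [isOpen_ball.mem_nhds hw1, isOpen_ball.mem_nhds hw2, isOpen_ball.mem_nhds hw3]
        with x x1 x2 x3
      rw [← hkh _ ht1 ⟨x1, x3⟩, ← hkh _ hp1 ⟨x2, x3⟩]
  refine ⟨H, ⟨fun z hz => ?_, fun z hz => ?_⟩, fun z hz => (hHin z hz).symm⟩
  · by_cases hzr : z ∈ ball z₀ r
    · refine (hl.analytic z hzr).congr ?_
      filter_upwards [isOpen_ball.mem_nhds hzr] with t ht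
      exact (hHin t ht).symm
    · obtain ⟨hp1, hp2⟩ := hpr z (hnot z hzr)
      refine ((hk _ hp1).analytic z ?_).congr (hnear z hz hzr).symm
      rw [mem_ball_iff_norm] at hz
      rw [mem_ball, hp2]; linarith
  · by_cases hzr : z ∈ ball z₀ r
    · rw [hHin z hzr]; exact hl.lift z hzr
    · obtain ⟨hp1, hp2⟩ := hpr z (hnot z hzr)
      rw [hHout z hzr]
      refine (hk _ hp1).lift z ?_
      rw [mem_ball_iff_norm] at hz
      rw [mem_ball, hp2]; linarith

/-- Compactness of the closed disc minus a small disc around `z₀` gives a uniform radius for the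
local lifts, and finitely many steps of `extend` reach `R`. No local lifts are asked for at `z₀`, so
that the centre may be a point where `P` meets `S`. -/
lemma IsLiftingSetup.continuation {q P : ℂ → OnePoint ℂ} {S : Set (OnePoint ℂ)}
    (hs : IsLiftingSetup q P S) {z₀ : ℂ} {R ε : ℝ} (hε : 0 < ε) {h : ℂ → ℂ}
    (hl : IsLiftOn q P h (ball z₀ ε))
    (hloc : ∀ z ∈ closedBall z₀ R, z ≠ z₀ → ∃ r > 0, LiftsOn q P z r) :
    ∃ H, IsLiftOn q P H (ball z₀ R) ∧ H =ᶠ[𝓝 z₀] h := by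
  have hcomp : IsCompact (closedBall z₀ R \ ball z₀ ε) := (isCompact_closedBall z₀ R).diff isOpen_ball
  have hloc' : ∀ z ∈ closedBall z₀ R \ ball z₀ ε, ∃ r > 0, LiftsOn q P z r := fun z hz =>
    hloc z hz.1 fun h => hz.2 (h ▸ mem_ball_self hε)
  choose! ρ hρ hρl using hloc'
  obtain ⟨δ, hδ, hleb⟩ := lebesgue_number_lemma_of_metric hcomp
    (c := fun z : ↥(closedBall z₀ R \ ball z₀ ε) => ball (z : ℂ) (ρ z)) (fun _ => isOpen_ball)
    (fun z hz => Set.mem_iUnion.2 ⟨⟨z, hz⟩, mem_ball_self (hρ z hz)⟩)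
  have hunif : ∀ z ∈ closedBall z₀ R \ ball z₀ ε, LiftsOn q P z δ := fun z hz =>
    let ⟨i, hi⟩ := hleb z hz
    (hρl i i.2).mono hi
  have hind : ∀ n : ℕ, ∃ H, IsLiftOn q P H (ball z₀ (min R (ε + n * (δ / 4)))) ∧
      H =ᶠ[𝓝 z₀] h := by
    intro n
    induction n with
    | zero => exact ⟨h, hl.mono (ball_subset_ball (by simp)), EventuallyEq.rfl⟩
    | succ n ih =>
      obtain ⟨H, hH, hHe⟩ := ih
      have hn : (0 : ℝ) ≤ n * (δ / 4) := by positivity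
      rcases le_or_gt R (ε + n * (δ / 4)) with hR | hR
      · exact ⟨H, hH.mono (ball_subset_ball (by rw [min_eq_left hR]; exact min_le_left _ _)), hHe⟩
      · rw [min_eq_right hR.le] at hH
        have hr : 0 < ε + n * (δ / 4) := by linarith
        obtain ⟨H', hH', he⟩ := hs.extend hr hδ hH fun z hz => hunif z (by
          rw [mem_sphere] at hz
          refine ⟨?_, ?_⟩
          · rw [mem_closedBall, hz]; exact hR.le
          · rw [mem_ball, hz]; linarith)
        refine ⟨H', hH'.mono (ball_subset_ball ((min_le_right _ _).trans ?_)), ?_⟩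
        · push_cast; linarith
        · exact ((he.symm.eventuallyEq_of_mem (ball_mem_nhds z₀ hr))).trans hHe
  obtain ⟨n, hn⟩ := exists_nat_gt (R / (δ / 4))
  rw [div_lt_iff₀ (by linarith)] at hn
  obtain ⟨H, hH, hHe⟩ := hind n
  exact ⟨H, by rwa [min_eq_left (by linarith)] at hH, hHe⟩

/-- If local lifts exist everywhere, then every germ of a lift extends to the plane. -/
lemma IsLiftingSetup.exists_entire {q P : ℂ → OnePoint ℂ} {S : Set (OnePoint ℂ)}
    (hs : IsLiftingSetup q P S) {z₀ : ℂ} {ε : ℝ} (hε : 0 < ε) {h : ℂ → ℂ}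
    (hl : IsLiftOn q P h (ball z₀ ε)) (hloc : ∀ z, ∃ r > 0, LiftsOn q P z r) :
    ∃ H, IsLiftOn q P H Set.univ ∧ H =ᶠ[𝓝 z₀] h := by
  choose H hH hHe using fun n : ℕ =>
    hs.continuation (R := n) hε hl fun z _ _ => hloc z
  have hcompat : ∀ m n : ℕ, m ≤ n → Set.EqOn (H m) (H n) (ball z₀ m) := by
    intro m n hmn t ht
    have hm : (0 : ℝ) < m := dist_nonneg.trans_lt (mem_ball.1 ht)
    refine (hH m).analytic.eqOn_of_preconnected_of_eventuallyEq
      ((hH n).analytic.mono (ball_subset_ball (by exact_mod_cast hmn))) (convex_ball z₀ m).isPreconnected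
      (mem_ball_self hm) ((hHe m).trans (hHe n).symm) ht
  -- The entire lift is glued from the lifts on discs by evaluating at `z` the one on a disc
  -- containing `z`.
  choose N hN using fun z : ℂ => exists_nat_gt (dist z z₀)
  have key : ∀ n : ℕ, Set.EqOn (fun z => H (N z) z) (H n) (ball z₀ n) := by
    intro n t ht
    rcases le_total (N t) n with h | h
    · exact hcompat _ _ h (hN t)
    · exact (hcompat _ _ h ht).symm
  refine ⟨fun z => H (N z) z, ⟨fun z _ => ?_, fun z _ => (hH (N z)).lift z (hN z)⟩, ?_⟩
  · exact ((hH (N z)).analytic z (hN z)).congr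
      ((key (N z)).eventuallyEq_of_mem (isOpen_ball.mem_nhds (hN z))).symm
  · exact ((key 1).eventuallyEq_of_mem (ball_mem_nhds z₀ (by simp))).trans (hHe 1)

lemma eventually_notMem_of_finite {g : ℂ → OnePoint ℂ} {z : ℂ} (hg : HolomorphicToSphereAt g z)
    {n : ℕ} (hn : n ≠ 0) (hdeg : localDegree g z = n) {S : Set (OnePoint ℂ)} (hS : S.Finite) :
    ∀ᶠ t in 𝓝[≠] z, g t ∉ S := by
  have h1 : ∀ᶠ w in 𝓝 (g z), w ∉ S \ {g z} :=
    (hS.subset Set.sdiff_subset).isClosed.isOpen_compl.mem_nhds (by simp)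
  filter_upwards [nhdsWithin_le_nhds (hg.1.eventually h1), eventually_ne_of_localDegree hg hn hdeg]
    with t a b h
  exact a ⟨h, b⟩

lemma dense_of_eventually_punctured {p : ℂ → Prop} (h : ∀ z, ∀ᶠ t in 𝓝[≠] z, p t) :
    Dense {t | p t} := fun z =>
  mem_closure_iff_frequently.2 ((h z).frequently.filter_mono nhdsWithin_le_nhds)

/-! ### Lifting one doubly branched cover through another. -/

namespace IsDoublyBranchedCover

variable {q : ℂ → OnePoint ℂ} {S : Set (OnePoint ℂ)}

lemma exists_degree (hq : IsDoublyBranchedCover q S) (z : ℂ) :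
    ∃ n : ℕ, n ≠ 0 ∧ n ≤ 2 ∧ localDegree q z = n := by
  by_cases h : q z ∈ S
  · exact ⟨2, by simp, le_rfl, hq.degree_over z h⟩
  · exact ⟨1, by simp, by simp, by simpa using hq.degree_off z h⟩

lemma mem_branchPoints (hq : IsDoublyBranchedCover q S) {z : ℂ} : z ∈ branchPoints q ↔ q z ∈ S := by
  refine ⟨fun h => ?_, fun h => ?_⟩
  · by_contra hz
    have : 1 < localDegree q z := h
    rw [hq.degree_off z hz] at this
    exact lt_irrefl _ this
  · change 1 < localDegree q z
    rw [hq.degree_over z h]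
    norm_num

lemma eventually_notMem (hq : IsDoublyBranchedCover q S) (hS : S.Finite) (z : ℂ) :
    ∀ᶠ t in 𝓝[≠] z, q t ∉ S :=
  let ⟨_, hn, _, hd⟩ := hq.exists_degree z
  eventually_notMem_of_finite (hq.holomorphic.at z) hn hd hS

/-- The exponent `k` belongs to topological charts and is not a priori tied to the analytic local
degree. It is bounded by the degree at the centre `φ.symm 0` of the sheet, which lies over `y`,
since nearby fibres have `k` points in the sheet. -/
lemma exists_chart (hq : IsDoublyBranchedCover q S) (y : OnePoint ℂ) :
    ∃ ψ : OpenPartialHomeomorph (OnePoint ℂ) ℂ, y ∈ ψ.source ∧ ψ y = 0 ∧ ψ.target = ball 0 1 ∧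
      ∀ x, q x ∈ ψ.source → ∃ k : ℕ, 1 ≤ k ∧ k ≤ 2 ∧ (y ∉ S → k = 1) ∧
        ∃ φ : OpenPartialHomeomorph ℂ ℂ, φ.source = connectedComponentIn (q ⁻¹' ψ.source) x ∧
          φ.target = ball 0 1 ∧ (∀ v ∈ φ.source, ψ (q v) = φ v ^ k) ∧ q (φ.symm 0) = y := by
  obtain ⟨ψ, hy, hy0, ht, h⟩ := hq.branchedCover.2 y
  refine ⟨ψ, hy, hy0, ht, fun x hx => ?_⟩
  obtain ⟨k, hk, φ, hs, hφt, hφ⟩ := h x hx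
  have h0 : (0 : ℂ) ∈ φ.target := by rw [hφt]; exact mem_ball_self one_pos
  have hsub : ∀ v ∈ φ.source, q v ∈ ψ.source := fun v hv =>
    connectedComponentIn_subset (q ⁻¹' ψ.source) x (hs ▸ hv)
  have hc : q (φ.symm 0) = y := by
    refine ψ.injOn (hsub _ (φ.map_target h0)) hy ?_
    rw [hφ _ (φ.map_target h0), φ.right_inv h0, hy0, zero_pow (by omega)]
  obtain ⟨n, hn, hn2, hdeg⟩ := hq.exists_degree (φ.symm 0)
  have hkn : k ≤ n := by
    refine le_localDegree_of_pow_eq (hq.holomorphic.at _) hn hdeg (e := φ.symm) (by omega)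
      (φ.continuousAt_symm h0) rfl (by rw [← hφt]; exact φ.symm.injOn) ?_
    rw [← hφt]
    intro u hu v hv huv
    refine ψ.injOn (hsub _ (φ.map_target hu)) (hsub _ (φ.map_target hv)) ?_
    rw [hφ _ (φ.map_target hu), hφ _ (φ.map_target hv), φ.right_inv hu, φ.right_inv hv, huv]
  refine ⟨k, hk, hkn.trans hn2, fun hyS => ?_, φ, hs, hφt, hφ, hc⟩
  have h1 := hq.degree_off (φ.symm 0) (by rwa [hc])
  rw [hdeg] at h1
  have : n = 1 := by exact_mod_cast h1
  omega

/-- Off `S` every sheet is mapped homeomorphically, so its inverse composed with `P` is a lift. The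
radius depends on `ψ` alone and thus serves all sheets. -/
lemma exists_liftsOn_of_notMem (hq : IsDoublyBranchedCover q S) (hS : S.Finite)
    {P : ℂ → OnePoint ℂ} (hP : IsHolomorphicToSphere P) {z : ℂ} (hz : P z ∉ S) :
    ∃ r > 0, LiftsOn q P z r := by
  obtain ⟨ψ, hy, hy0, hψt, h⟩ := hq.exists_chart (P z)
  have hev : ∀ᶠ t in 𝓝 z, P t ∈ ψ.source ∧ P t ∉ S :=
    (hP.1.continuousAt.eventually (ψ.open_source.mem_nhds hy)).and
      (hP.1.continuousAt.eventually (hS.isClosed.isOpen_compl.mem_nhds hz))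
  obtain ⟨r, hr, hball⟩ := Metric.eventually_nhds_iff_ball.1 hev
  refine ⟨r, hr, fun v hv w hw => ?_⟩
  obtain ⟨k, -, -, hk, φ, hs, hφt, hφ, -⟩ := h w (by rw [hw]; exact (hball v hv).1)
  obtain rfl := hk hz
  simp only [pow_one] at hφ
  have hsub : ∀ v ∈ φ.source, q v ∈ ψ.source := fun v hv =>
    connectedComponentIn_subset (q ⁻¹' ψ.source) w (hs ▸ hv)
  have htar : ∀ t ∈ ball z r, ψ (P t) ∈ φ.target := fun t ht => by
    rw [hφt, ← hψt]; exact ψ.map_source (hball t ht).1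
  have hlift : ∀ t ∈ ball z r, q (φ.symm (ψ (P t))) = P t := fun t ht => by
    have hm := φ.map_target (htar t ht)
    refine ψ.injOn (hsub _ hm) (hball t ht).1 ?_
    rw [hφ _ hm, φ.right_inv (htar t ht)]
  refine ⟨fun t => φ.symm (ψ (P t)), ⟨fun t ht => ?_, hlift⟩, ?_⟩
  · have hcont : ContinuousAt (fun t => φ.symm (ψ (P t))) t :=
      ContinuousAt.comp (f := fun t => ψ (P t)) (g := φ.symm) (φ.continuousAt_symm (htar t ht))
        (ContinuousAt.comp (f := P) (g := ψ) (ψ.continuousAt (hball t ht).1) hP.1.continuousAt)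
    refine analyticAt_of_continuous_lift (hq.holomorphic.at _)
      (hq.degree_off _ (by rw [hlift t ht]; exact (hball t ht).2)) (hP.at t) hcont ?_
    filter_upwards [isOpen_ball.mem_nhds ht] with x hx using hlift x hx
  · have hw' : w ∈ φ.source := by
      rw [hs]; exact mem_connectedComponentIn (by rw [Set.mem_preimage, hw]; exact (hball v hv).1)
    change φ.symm (ψ (P v)) = w
    rw [← hw, hφ w hw', φ.left_inv hw']

/-- Over a small disc around a point of `S` the sheets of the cover are uniformly parametrized by
square roots of the coordinate. -/
lemma exists_sqrt_parametrization (hq : IsDoublyBranchedCover q S) (hS : S.Finite) {y : OnePoint ℂ}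
    (hy : y ∈ S) : ∃ ρ > 0, ∀ x, ∀ u₀ ∈ ball (0 : ℂ) ρ, q x = paramAt y (u₀ ^ 2) →
      ∃ s, IsLiftOn q (fun u => paramAt y (u ^ 2)) s (ball 0 ρ) ∧ ∃ u ∈ ball (0 : ℂ) ρ, s u = x := by
  set P : ℂ → OnePoint ℂ := fun u => paramAt y (u ^ 2) with hPdef
  have hP : IsHolomorphicToSphere P := isHolomorphicToSphere_iff.2 fun z =>
    holomorphicToSphereAt_paramAt y (by fun_prop)
  have hP0 : P 0 = y := by simp [hPdef]
  have hPne : ∀ u, u ≠ 0 → P u ≠ y := fun u hu h => by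
    have : u ^ 2 = 0 := paramAt_injective y (by rw [paramAt_zero]; exact h)
    exact hu (by simpa using this)
  have hdense : Dense {t | P t ∉ S} := by
    have hfin : (P ⁻¹' S).Finite := by
      have : (paramAt y ⁻¹' S).Finite := hS.preimage (paramAt_injective y).injOn
      refine Set.Finite.subset (this.biUnion fun a _ =>
        ((Polynomial.nthRoots 2 a).toFinset.finite_toSet)) fun u hu => ?_
      simp only [Set.mem_iUnion]
      exact ⟨u ^ 2, hu, by simp [Polynomial.mem_nthRoots]⟩
    exact hfin.countable.dense_compl ℝ
  have hset : IsLiftingSetup q P S := ⟨hq.holomorphic, hq.degree_off, hdense⟩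
  obtain ⟨ψ, hyψ, hy0, hψt, h⟩ := hq.exists_chart y
  have hev : ∀ᶠ u in 𝓝 (0 : ℂ), P u ∈ ψ.source ∧ P u ∉ S \ {y} := by
    refine (hP.1.continuousAt.eventually (ψ.open_source.mem_nhds (by rwa [hP0]))).and
      (hP.1.continuousAt.eventually
        ((hS.subset Set.sdiff_subset).isClosed.isOpen_compl.mem_nhds (by simp [hP0])))
  obtain ⟨ρ₀, hρ₀, hball⟩ := Metric.eventually_nhds_iff_ball.1 hev
  have hgood : ∀ u ∈ closedBall (0 : ℂ) (ρ₀ / 2), P u ∈ ψ.source ∧ (u ≠ 0 → P u ∉ S) := by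
    intro u hu
    obtain ⟨h1, h2⟩ := hball u (closedBall_subset_ball (by linarith) hu)
    exact ⟨h1, fun hu0 hS => h2 ⟨hS, hPne u hu0⟩⟩
  refine ⟨ρ₀ / 2, by linarith, fun x u₀ hu₀ hx => ?_⟩
  have hxs : q x ∈ ψ.source := by rw [hx]; exact (hgood u₀ (ball_subset_closedBall hu₀)).1
  obtain ⟨k, hk1, hk2, -, φ, hs, hφt, hφ, hc⟩ := h x hxs
  set c := φ.symm 0 with hcdef
  have h0 : (0 : ℂ) ∈ φ.target := by rw [hφt]; exact mem_ball_self one_pos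
  have hcs : c ∈ φ.source := φ.map_target h0
  have hxφ : x ∈ φ.source := by rw [hs]; exact mem_connectedComponentIn hxs
  obtain ⟨κ, s₀, -, hκ0, hs₀, hs₀0, -, hqs, hκs, -⟩ := exists_normalForm (hq.holomorphic.at c)
    two_ne_zero (hq.degree_over c (by rwa [hc]))
  rw [hc] at hqs
  obtain ⟨ε, hε, hεb⟩ := Metric.eventually_nhds_iff_ball.1 (hs₀.eventually_analyticAt.and hqs)
  -- The square-root germ at the centre of the sheet extends to a disc independent of the sheet:
  -- away from `0` the values `P u` avoid `S`, so local lifts exist there.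
  obtain ⟨s, hsl, hse⟩ := hset.continuation (R := ρ₀ / 2) hε
    ⟨fun u hu => (hεb u hu).1, fun u hu => (hεb u hu).2⟩
    fun u hu hu0 => hq.exists_liftsOn_of_notMem hS hP ((hgood u hu).2 hu0)
  have hpos : 0 < ρ₀ / 2 := by linarith
  refine ⟨s, hsl, ?_⟩
  have hs0 : s 0 = c := by rw [hse.self_of_nhds, hs₀0]
  have hmaps : ∀ u ∈ ball (0 : ℂ) (ρ₀ / 2), s u ∈ φ.source := by
    have himg : IsPreconnected (s '' ball 0 (ρ₀ / 2)) :=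
      (convex_ball (0 : ℂ) _).isPreconnected.image s hsl.analytic.continuousOn
    have hsub : s '' ball 0 (ρ₀ / 2) ⊆ q ⁻¹' ψ.source := by
      rintro _ ⟨u, hu, rfl⟩
      rw [Set.mem_preimage, hsl.lift u hu]
      exact (hgood u (ball_subset_closedBall hu)).1
    have := himg.subset_connectedComponentIn ⟨0, mem_ball_self hpos, hs0⟩ hsub
    rw [← connectedComponentIn_eq (hs ▸ hcs), ← hs] at this
    exact fun u hu => this ⟨u, hu, rfl⟩
  have hpow : ∀ u ∈ ball (0 : ℂ) (ρ₀ / 2), φ (s u) ^ k = ψ (P u) := fun u hu => by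
    rw [← hφ _ (hmaps u hu), hsl.lift u hu]
  have hxpow : φ x ^ k = ψ (P u₀) := by rw [← hφ x hxφ, hx]
  by_cases hu0 : u₀ = 0
  · refine ⟨0, mem_ball_self hpos, ?_⟩
    rw [hu0, hP0, hy0, pow_eq_zero_iff (by omega)] at hxpow
    rw [hs0, hcdef, ← hxpow, φ.left_inv hxφ]
  · have hneg : -u₀ ∈ ball (0 : ℂ) (ρ₀ / 2) := by simpa using hu₀
    have hPneg : ∀ u, P (-u) = P u := fun u => by simp [hPdef]
    -- Equality would make `s` even by uniqueness of lifts, but `s` is injective near `0`. The two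
    -- distinct values force `k = 2` and exhaust the square roots, so `x` is `s u₀` or `s (-u₀)`.
    have hne : φ (s u₀) ≠ φ (s (-u₀)) := by
      intro heq
      have heq' := φ.injOn (hmaps _ hu₀) (hmaps _ hneg) heq
      have hsneg : IsLiftOn q P (fun u => s (-u)) (ball 0 (ρ₀ / 2)) := by
        refine ⟨fun u hu => ?_, fun u hu => ?_⟩
        · exact AnalyticAt.comp (g := s) (hsl.analytic _ (by simpa using hu)) (by fun_prop)
        · have h' : -u ∈ ball (0 : ℂ) (ρ₀ / 2) := by simpa using hu
          rw [← hPneg u]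
          exact hsl.lift _ h'
      have hEq := hset.eqOn (convex_ball (0 : ℂ) (ρ₀ / 2)).isPreconnected isOpen_ball hsl hsneg hu₀
        ((hgood u₀ (ball_subset_closedBall hu₀)).2 hu0) heq'
      have hcontra : ∀ᶠ u in 𝓝 (0 : ℂ), u = -u := by
        have hn : Tendsto (fun u : ℂ => -u) (𝓝 0) (𝓝 0) := by
          simpa using (continuous_neg (G := ℂ)).tendsto 0
        filter_upwards [hse, hn.eventually hse, hκs, hn.eventually hκs, ball_mem_nhds (0 : ℂ) hpos]
          with u a b d e f
        have : s u = s (-u) := hEq f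
        rw [a, b] at this
        rw [← e, ← this, d]
      have hcontra' : ∀ᶠ u : ℂ in 𝓝[≠] 0, False := by
        filter_upwards [nhdsWithin_le_nhds hcontra, self_mem_nhdsWithin] with u a b
        exact b (self_eq_neg.1 a)
      exact hcontra'.exists.elim fun _ h => h
    have h1 := hpow u₀ hu₀
    have h2 := hpow (-u₀) hneg
    rw [hPneg] at h2
    rw [← hxpow] at h1 h2
    have hk : k = 2 := by
      by_contra hk2'
      have : k = 1 := by omega
      subst this
      simp only [pow_one] at h1 h2
      exact hne (by rw [h1, h2])
    subst hk
    rcases sq_eq_sq_iff_eq_or_eq_neg.1 h1 with h1 | h1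
    · exact ⟨u₀, hu₀, φ.injOn (hmaps _ hu₀) hxφ h1⟩
    · rcases sq_eq_sq_iff_eq_or_eq_neg.1 h2 with h2 | h2
      · exact ⟨-u₀, hneg, φ.injOn (hmaps _ hneg) hxφ h2⟩
      · exact absurd (h1.trans h2.symm) hne

variable {p : ℂ → OnePoint ℂ}

lemma isLiftingSetup (hp : IsDoublyBranchedCover p S) (hq : IsDoublyBranchedCover q S)
    (hS : S.Finite) : IsLiftingSetup q p S :=
  ⟨hq.holomorphic, hq.degree_off, dense_of_eventually_punctured (hp.eventually_notMem hS)⟩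

/-- Over a point of `S`, `p` is `g ^ 2` in a coordinate, so composing a square-root parametrization
of the sheet of `q` with `g` or `-g` gives a lift. The sign is dictated by the prescribed value. -/
lemma exists_liftsOn (hp : IsDoublyBranchedCover p S) (hq : IsDoublyBranchedCover q S)
    (hS : S.Finite) (z : ℂ) : ∃ r > 0, LiftsOn q p z r := by
  by_cases hz : p z ∈ S
  · obtain ⟨ρ, hρ, hpar⟩ := hq.exists_sqrt_parametrization hS hz
    obtain ⟨g, -, hg, hg0, -, -, hpg, -, -, -⟩ := exists_normalForm (hp.holomorphic.at z) two_ne_zero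
      (hp.degree_over z hz)
    have hev : ∀ᶠ t in 𝓝 z, (AnalyticAt ℂ g t ∧ g t ∈ ball 0 ρ) ∧ p t = paramAt (p z) (g t ^ 2) :=
      (hg.eventually_analyticAt.and
        (hg.continuousAt.eventually (by rw [hg0]; exact ball_mem_nhds 0 hρ))).and hpg
    obtain ⟨r, hr, hball⟩ := Metric.eventually_nhds_iff_ball.1 hev
    refine ⟨r, hr, fun v hv w hw => ?_⟩
    obtain ⟨⟨-, hgv⟩, hpv⟩ := hball v hv
    obtain ⟨s, hs, u, hu, hsu⟩ := hpar w (g v) hgv (by rw [hw, hpv])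
    have hug : u ^ 2 = g v ^ 2 := by
      refine paramAt_injective (p z) ?_
      rw [← hpv, ← hw, ← hsu]
      exact (hs.lift u hu).symm
    rcases sq_eq_sq_iff_eq_or_eq_neg.1 hug with h | h
    · refine ⟨fun t => s (g t), ⟨fun t ht => ?_, fun t ht => ?_⟩, by rw [← hsu, h]⟩
      · exact AnalyticAt.comp (g := s) (hs.analytic _ (hball t ht).1.2) (hball t ht).1.1
      · rw [hs.lift _ (hball t ht).1.2, (hball t ht).2]
    · have hn : ∀ t ∈ ball z r, -g t ∈ ball (0 : ℂ) ρ := fun t ht => by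
        simpa using (hball t ht).1.2
      refine ⟨fun t => s (-g t), ⟨fun t ht => ?_, fun t ht => ?_⟩, by rw [← hsu, h]⟩
      · exact AnalyticAt.comp (g := s) (hs.analytic _ (hn t ht)) (hball t ht).1.1.neg
      · rw [hs.lift _ (hn t ht), (hball t ht).2, neg_sq]
  · exact hq.exists_liftsOn_of_notMem hS hp.holomorphic hz

lemma lift_comp_eq_id (hp : IsDoublyBranchedCover p S) (hS : S.Finite) {h k : ℂ → ℂ}
    (hh : IsLiftOn q p h Set.univ) (hk : IsLiftOn p q k Set.univ) {v : ℂ} (hv : p v ∉ S)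
    (hkv : k (h v) = v) (z : ℂ) : k (h z) = z := by
  have hset := hp.isLiftingSetup hp hS
  refine hset.eqOn (h₁ := fun z => k (h z)) (h₂ := fun z => z) isPreconnected_univ isOpen_univ
    ⟨fun z _ => ?_, fun z _ => ?_⟩ ⟨fun z _ => analyticAt_id, fun z _ => rfl⟩ (Set.mem_univ v) hv hkv
    (Set.mem_univ z)
  · exact AnalyticAt.comp (g := k) (hk.analytic _ trivial) (hh.analytic z trivial)
  · rw [hk.lift _ trivial, hh.lift z trivial]

/-- Every germ of a lift between two covers branched over the same set is the germ of a biholomorphic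
map of the plane. -/
lemma exists_entire_lift (hp : IsDoublyBranchedCover p S) (hq : IsDoublyBranchedCover q S)
    (hS : S.Finite) {z₀ : ℂ} {ε : ℝ} (hε : 0 < ε) {h₀ : ℂ → ℂ} (hl : IsLiftOn q p h₀ (ball z₀ ε)) :
    ∃ h k : ℂ → ℂ, Differentiable ℂ h ∧ Differentiable ℂ k ∧ (∀ z, k (h z) = z) ∧
      (∀ z, h (k z) = z) ∧ (∀ z, q (h z) = p z) ∧ h =ᶠ[𝓝 z₀] h₀ := by
  obtain ⟨h, hh, he⟩ := (hp.isLiftingSetup hq hS).exists_entire hε hl (hp.exists_liftsOn hq hS)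
  obtain ⟨v, hv⟩ := (dense_of_eventually_punctured (hp.eventually_notMem hS)).nonempty
  have hqv : q (h v) = p v := hh.lift v trivial
  -- The inverse is the lift in the other direction that sends `h v` back to `v`; both composites
  -- are lifts of a cover through itself agreeing with the identity at one unbranched point.
  obtain ⟨r, hr, hL⟩ := hq.exists_liftsOn hp hS (h v)
  obtain ⟨k₀, hk₀, hk₀v⟩ := hL (h v) (mem_ball_self hr) v hqv.symm
  obtain ⟨k, hk, hke⟩ := (hq.isLiftingSetup hp hS).exists_entire hr hk₀ (hq.exists_liftsOn hp hS)
  have hkv : k (h v) = v := by rw [hke.self_of_nhds, hk₀v]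
  exact ⟨h, k, fun z => (hh.analytic z trivial).differentiableAt,
    fun z => (hk.analytic z trivial).differentiableAt, hp.lift_comp_eq_id hS hh hk hv hkv,
    hq.lift_comp_eq_id hS hk hh (v := h v) (by rwa [hqv]) (by rw [hkv]),
    fun z => hh.lift z trivial, he⟩

end IsDoublyBranchedCover

/-! ### Biholomorphic maps of the plane. -/

/-- A biholomorphic map of the plane is affine. -/
lemma exists_affine_of_entire_inverse {h k : ℂ → ℂ} (hh : Differentiable ℂ h)
    (hk : Differentiable ℂ k) (hkh : ∀ z, k (h z) = z) (hhk : ∀ z, h (k z) = z) :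
    ∃ a b : ℂ, a ≠ 0 ∧ ∀ z, h z = a * z + b := by
  set f : ℂ → ℂ := fun z => h z - h 0 with hf
  set g : ℂ → ℂ := fun z => k (z + h 0) with hg
  have hfd : Differentiable ℂ f := hh.sub_const _
  have hgd : Differentiable ℂ g := hk.comp (differentiable_id.add_const _)
  have hgf : ∀ z, g (f z) = z := fun z => by simp [hf, hg, hkh]
  have hfg : ∀ z, f (g z) = z := fun z => by simp [hf, hg, hhk]
  have hf0 : f 0 = 0 := by simp [hf]
  have hg0 : g 0 = 0 := by rw [← hf0, hgf, hf0]
  have hcoc : ∀ (f g : ℂ → ℂ), Continuous g → (∀ z, g (f z) = z) →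
      Tendsto f (cocompact ℂ) (cocompact ℂ) := fun f g hg hgf => by
    refine (hasBasis_cocompact.tendsto_right_iff).2 fun K hK => ?_
    filter_upwards [(hK.image hg).compl_mem_cocompact] with z hz hfz
    exact hz ⟨f z, hfz, hgf z⟩
  have hft := hcoc f g hgd.continuous hgf
  have hgt := hcoc g f hfd.continuous hfg
  -- This is the inverse map read at `∞`. The convention `0⁻¹ = 0` and `g 0 = 0` give `G 0 = 0`, the
  -- right value because `g` is proper, so the singularity is removable.
  set G : ℂ → ℂ := fun w => (g w⁻¹)⁻¹ with hG
  have hG0 : G 0 = 0 := by simp [hG, hg0]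
  have hinv : Tendsto (fun w : ℂ => w⁻¹) (𝓝[≠] 0) (cocompact ℂ) := by
    rw [← Metric.cobounded_eq_cocompact]
    exact tendsto_inv₀_nhdsNE_zero
  have hinv' : Tendsto (fun w : ℂ => w⁻¹) (cocompact ℂ) (𝓝 0) := by
    rw [← Metric.cobounded_eq_cocompact]
    exact tendsto_inv₀_cobounded
  have hGa : AnalyticAt ℂ G 0 := by
    refine Complex.analyticAt_of_differentiable_on_punctured_nhds_of_continuousAt ?_ ?_
    · filter_upwards [self_mem_nhdsWithin] with w hw
      have hw0 : w ≠ 0 := hw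
      have hne : g w⁻¹ ≠ 0 := fun h => inv_ne_zero hw0 (by rw [← hfg w⁻¹, h, hf0])
      exact ((hgd _).comp w (differentiableAt_inv hw0)).inv hne
    · rw [continuousAt_iff_punctured_nhds, hG0]
      exact hinv'.comp (hgt.comp hinv)
  -- The bound `‖G w‖ ≤ C ‖w‖` at `w = (f z)⁻¹` reads `‖f z‖ ≤ C ‖z‖` for large `z`; Liouville then
  -- applies to `f z / z`.
  obtain ⟨C, hC⟩ := hGa.differentiableAt.isBigO_sub.bound
  simp only [hG0, sub_zero] at hC
  have hlarge : ∀ᶠ z in cocompact ℂ, ‖dslope f 0 z‖ ≤ C := by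
    filter_upwards [(hinv'.comp hft).eventually hC,
      (isCompact_singleton (x := (0 : ℂ))).compl_mem_cocompact] with z hz hz0
    have hz0' : z ≠ 0 := hz0
    have hfz : f z ≠ 0 := fun h => hz0' (by rw [← hgf z, h, hg0])
    simp only [hG, Function.comp, inv_inv, hgf, norm_inv] at hz
    rw [dslope_of_ne _ hz0', slope_def_field, hf0, sub_zero, sub_zero, norm_div,
      div_le_iff₀ (norm_pos_iff.2 hz0')]
    have h1 := norm_pos_iff.2 hfz
    have h2 := norm_pos_iff.2 hz0'
    rw [← div_eq_mul_inv, inv_le_iff_one_le_mul₀ h2, div_mul_eq_mul_div, le_div_iff₀ h1, one_mul] at hz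
    exact hz
  have hds : Differentiable ℂ (dslope f 0) := by
    intro z
    by_cases hz : z = 0
    · subst hz
      have := (Complex.differentiableOn_dslope (c := (0 : ℂ)) (s := Set.univ) (f := f) univ_mem).2
        hfd.differentiableOn
      exact (this 0 trivial).differentiableAt univ_mem
    · exact (differentiableAt_dslope_of_ne hz).2 (hfd z)
  have hbdd : Bornology.IsBounded (Set.range (dslope f 0)) := by
    obtain ⟨K, hK, hKs⟩ := mem_cocompact.1 hlarge
    obtain ⟨M, hM⟩ := hK.exists_bound_of_continuousOn hds.continuous.continuousOn
    refine isBounded_iff_forall_norm_le.2 ⟨max M C, ?_⟩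
    rintro _ ⟨z, rfl⟩
    by_cases hz : z ∈ K
    · exact (hM z hz).trans (le_max_left _ _)
    · exact le_max_of_le_right (hKs hz)
  have hlin : ∀ z, f z = dslope f 0 0 * z := fun z => by
    have h1 := sub_smul_dslope f 0 z
    rw [hds.apply_eq_apply_of_bounded hbdd z 0, hf0] at h1
    simp only [sub_zero, smul_eq_mul] at h1
    rw [← h1, mul_comm]
  refine ⟨dslope f 0 0, h 0, fun h0 => ?_, fun z => ?_⟩
  · have h1 := hgf 1
    rw [hlin 1, h0, zero_mul, hg0] at h1
    exact zero_ne_one h1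
  · rw [← hlin z]; simp [hf]

/-! ### The deck group and the fibres of a cover. -/

namespace IsDoublyBranchedCover

variable {p q : ℂ → OnePoint ℂ} {S : Set (OnePoint ℂ)}

lemma exists_affine_of_germ (hp : IsDoublyBranchedCover p S) (hq : IsDoublyBranchedCover q S)
    (hS : S.Finite) {z₀ : ℂ} {ε : ℝ} (hε : 0 < ε) {h₀ : ℂ → ℂ} (hl : IsLiftOn q p h₀ (ball z₀ ε)) :
    ∃ a b : ℂ, a ≠ 0 ∧ (∀ z, q (a * z + b) = p z) ∧ ∀ᶠ z in 𝓝 z₀, a * z + b = h₀ z := by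
  obtain ⟨h, k, hh, hk, hkh, hhk, hl, he⟩ := hp.exists_entire_lift hq hS hε hl
  obtain ⟨a, b, ha, hab⟩ := exists_affine_of_entire_inverse hh hk hkh hhk
  refine ⟨a, b, ha, fun z => by rw [← hab, hl], he.mono fun z hz => by rw [← hab, hz]⟩

/-- Two covers branched over the same set differ by an affine map, with prescribed value. -/
lemma exists_affine_of_eq (hp : IsDoublyBranchedCover p S) (hq : IsDoublyBranchedCover q S)
    (hS : S.Finite) {z w : ℂ} (h : q w = p z) :
    ∃ a b : ℂ, a ≠ 0 ∧ (∀ t, q (a * t + b) = p t) ∧ a * z + b = w := by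
  obtain ⟨r, hr, hL⟩ := hp.exists_liftsOn hq hS z
  obtain ⟨k, hk, hkz⟩ := hL z (mem_ball_self hr) w h
  obtain ⟨a, b, ha, hab, he⟩ := hp.exists_affine_of_germ hq hS hr hk
  exact ⟨a, b, ha, hab, by rw [he.self_of_nhds, hkz]⟩

/-- If `a ≠ 1` there is a fixed point `ζ`. Comparing leading terms of `p` there gives `a ^ n = 1`,
where `n ≤ 2` is the local degree. -/
lemma eq_one_or_neg_one (hp : IsDoublyBranchedCover p S) {a b : ℂ}
    (hab : ∀ t, p (a * t + b) = p t) : a = 1 ∨ a = -1 := by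
  by_cases ha : a = 1
  · exact Or.inl ha
  have ha' : 1 - a ≠ 0 := sub_ne_zero.2 (Ne.symm ha)
  set ζ := b / (1 - a) with hζ
  have hfix : a * ζ + b = ζ := by rw [hζ]; field_simp; ring
  obtain ⟨n, hn, hn2, hdeg⟩ := hp.exists_degree ζ
  obtain ⟨G, hG, hG0, hGe⟩ := ((hp.holomorphic.at ζ).2.analyticOrderAt_eq_natCast).1 hdeg
  have hcont : Tendsto (fun t => a * t + b) (𝓝 ζ) (𝓝 ζ) := by
    have : Continuous fun t : ℂ => a * t + b := by fun_prop
    simpa [hfix] using this.tendsto ζ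
  have hpun : ∀ᶠ t in 𝓝[≠] ζ, a ^ n * G (a * t + b) = G t := by
    filter_upwards [nhdsWithin_le_nhds hGe, nhdsWithin_le_nhds (hcont.eventually hGe),
      self_mem_nhdsWithin] with t h1 h2 h3
    rw [hab, h1, smul_eq_mul, smul_eq_mul] at h2
    have h4 : a * t + b - ζ = a * (t - ζ) := by linear_combination hfix
    rw [h4, mul_pow] at h2
    have h5 : (t - ζ) ^ n ≠ 0 := pow_ne_zero _ (sub_ne_zero.2 h3)
    refine mul_left_cancel₀ h5 ?_
    rw [h2]; ring
  have hlim1 : Tendsto (fun t => a ^ n * G (a * t + b)) (𝓝[≠] ζ) (𝓝 (a ^ n * G ζ)) :=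
    ((hG.continuousAt.tendsto.comp hcont).const_mul _).mono_left nhdsWithin_le_nhds
  have hlim2 : Tendsto G (𝓝[≠] ζ) (𝓝 (G ζ)) :=
    hG.continuousAt.tendsto.mono_left nhdsWithin_le_nhds
  have heq : a ^ n * G ζ = G ζ := tendsto_nhds_unique (hlim1.congr' hpun) hlim2
  have han : a ^ n = 1 := mul_right_cancel₀ hG0 (by rw [heq, one_mul])
  interval_cases n
  · exact absurd rfl hn
  · exact Or.inl (by simpa using han)
  · exact sq_eq_sq_iff_eq_or_eq_neg.1 (by rw [han, one_pow])

/-- The half-turn about a branch point is a deck transformation. -/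
lemma apply_two_mul_sub (hp : IsDoublyBranchedCover p S) (hS : S.Finite) {l : ℂ}
    (hl : l ∈ branchPoints p) (t : ℂ) : p (2 * l - t) = p t := by
  rw [hp.mem_branchPoints] at hl
  obtain ⟨k, s, hk, hk0, hs, hs0, hpk, hps, hks, hsk⟩ := exists_normalForm (hp.holomorphic.at l)
    two_ne_zero (hp.degree_over l hl)
  have hkn : Tendsto (fun t => -k t) (𝓝 l) (𝓝 0) := by
    have h := hk.continuousAt.tendsto.neg
    rwa [hk0, neg_zero] at h
  have hev : ∀ᶠ t in 𝓝 l, AnalyticAt ℂ (fun t => s (-k t)) t ∧ p (s (-k t)) = p t := by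
    refine (AnalyticAt.eventually_analyticAt
      (AnalyticAt.comp (g := s) (by simpa [hk0] using hs) hk.neg)).and ?_
    filter_upwards [hpk, hkn.eventually hps] with t h1 h2
    rw [h1, h2, neg_sq]
  obtain ⟨ε, hε, hball⟩ := Metric.eventually_nhds_iff_ball.1 hev
  obtain ⟨a, b, -, hab, he⟩ := hp.exists_affine_of_germ hp hS hε
    ⟨fun t ht => (hball t ht).1, fun t ht => (hball t ht).2⟩
  have hl' : a * l + b = l := by rw [he.self_of_nhds, hk0, neg_zero, hs0]
  rcases hp.eq_one_or_neg_one hab with rfl | rfl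
  · exfalso
    have hb : b = 0 := by linear_combination hl'
    have hcontra : ∀ᶠ t in 𝓝 l, t = l := by
      filter_upwards [he, hkn.eventually hks, hsk] with t h1 h2 h3
      rw [hb, one_mul, add_zero] at h1
      rw [← h1] at h2
      rw [← h3, self_eq_neg.1 h2, hs0]
    have hcontra' : ∀ᶠ t in 𝓝[≠] l, False := by
      filter_upwards [nhdsWithin_le_nhds hcontra, self_mem_nhdsWithin] with u a b using b a
    exact hcontra'.exists.elim fun _ h => h
  · have hb : b = 2 * l := by linear_combination hl'
    rw [← hab t, hb]
    congr 1; ring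

lemma apply_neg (hp : IsDoublyBranchedCover p S) (hS : S.Finite) (h0 : (0 : ℂ) ∈ branchPoints p)
    (t : ℂ) : p (-t) = p t := by
  simpa using hp.apply_two_mul_sub hS h0 t

lemma apply_add_two_mul (hp : IsDoublyBranchedCover p S) (hS : S.Finite)
    (h0 : (0 : ℂ) ∈ branchPoints p) {l : ℂ} (hl : l ∈ branchPoints p) (t : ℂ) :
    p (t + 2 * l) = p t := by
  rw [← hp.apply_neg hS h0 t, ← hp.apply_two_mul_sub hS hl (-t)]
  congr 1; ring

/-- Since `p` is even, a period `b` makes `t ↦ b - t` a symmetry of `p`. It fixes `b / 2`, so `p` is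
not injective near that point. -/
lemma half_mem_branchPoints (hp : IsDoublyBranchedCover p S) (hS : S.Finite)
    (h0 : (0 : ℂ) ∈ branchPoints p) {b : ℂ} (hb : ∀ t, p (t + b) = p t) :
    b / 2 ∈ branchPoints p := by
  by_contra hmem
  rw [hp.mem_branchPoints] at hmem
  obtain ⟨V, hV, hinj⟩ := exists_injOn_of_localDegree_eq_one (hp.holomorphic.at _)
    (hp.degree_off _ hmem)
  have hcont : Tendsto (fun t : ℂ => b - t) (𝓝 (b / 2)) (𝓝 (b / 2)) := by
    have : Continuous fun t : ℂ => b - t := by fun_prop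
    convert! this.tendsto (b / 2) using 2
    ring
  have hcontra : ∀ᶠ t in 𝓝 (b / 2), t = b / 2 := by
    filter_upwards [hV, hcont hV] with t h1 h2
    have : p t = p (b - t) := by
      rw [← hp.apply_neg hS h0 t, ← hb (-t)]
      congr 1; ring
    have := hinj h1 h2 this
    linear_combination this / 2
  have hcontra' : ∀ᶠ t in 𝓝[≠] (b / 2), False := by
    filter_upwards [nhdsWithin_le_nhds hcontra, self_mem_nhdsWithin] with u a b using b a
  exact hcontra'.exists.elim fun _ h => h

/-- The branch points form a group if the origin is one of them. -/
lemma sub_mem_branchPoints (hp : IsDoublyBranchedCover p S) (hS : S.Finite)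
    (h0 : (0 : ℂ) ∈ branchPoints p) {l m : ℂ} (hl : l ∈ branchPoints p) (hm : m ∈ branchPoints p) :
    l - m ∈ branchPoints p := by
  -- Both `2l` and `2m` are periods, hence so is their difference.
  have := hp.half_mem_branchPoints hS h0 (b := 2 * (l - m)) fun t => by
    rw [← hp.apply_add_two_mul hS h0 hm (t + 2 * (l - m)), ← hp.apply_add_two_mul hS h0 hl t]
    congr 1; ring
  rwa [mul_div_cancel_left₀ _ two_ne_zero] at this

lemma neg_mem_branchPoints (hp : IsDoublyBranchedCover p S) (hS : S.Finite)
    (h0 : (0 : ℂ) ∈ branchPoints p) {l : ℂ} (hl : l ∈ branchPoints p) : -l ∈ branchPoints p := by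
  simpa using hp.sub_mem_branchPoints hS h0 h0 hl

lemma add_mem_branchPoints (hp : IsDoublyBranchedCover p S) (hS : S.Finite)
    (h0 : (0 : ℂ) ∈ branchPoints p) {l m : ℂ} (hl : l ∈ branchPoints p) (hm : m ∈ branchPoints p) :
    l + m ∈ branchPoints p := by
  simpa using hp.sub_mem_branchPoints hS h0 hl (hp.neg_mem_branchPoints hS h0 hm)

/-- The fibres of the cover are the orbits of the group of all `z ↦ ± z + 2 l` with `l` a branch
point. -/
lemma eq_iff (hp : IsDoublyBranchedCover p S) (hS : S.Finite) (h0 : (0 : ℂ) ∈ branchPoints p)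
    {z w : ℂ} : p z = p w ↔ ∃ l ∈ branchPoints p, w = z + 2 * l ∨ w = -z + 2 * l := by
  constructor
  · intro h
    obtain ⟨a, b, -, hab, hw⟩ := hp.exists_affine_of_eq hp hS (z := z) (w := w) h.symm
    have hb : ∀ t, p (t + b) = p t := by
      rcases hp.eq_one_or_neg_one hab with rfl | rfl
      · simpa using hab
      · intro t
        rw [← hp.apply_neg hS h0 t, ← hab (-t)]
        congr 1; ring
    refine ⟨b / 2, hp.half_mem_branchPoints hS h0 hb, ?_⟩
    rcases hp.eq_one_or_neg_one hab with rfl | rfl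
    · left; linear_combination -hw
    · right; linear_combination -hw
  · rintro ⟨l, hl, rfl | rfl⟩
    · exact (hp.apply_add_two_mul hS h0 hl z).symm
    · rw [hp.apply_add_two_mul hS h0 hl, hp.apply_neg hS h0]

lemma eventually_notMem_branchPoints_of_affine (hp : IsDoublyBranchedCover p S) (hS : S.Finite)
    {c d : ℂ} (h : ¬(c = 0 ∧ d ∈ branchPoints p)) :
    ∀ᶠ t in 𝓝[≠] (0 : ℂ), c * t + d ∉ branchPoints p := by
  by_cases hc : c = 0
  · have hd : d ∉ branchPoints p := fun hd => h ⟨hc, hd⟩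
    simp [hc, hd]
  · have ht : Tendsto (fun t => c * t + d) (𝓝[≠] 0) (𝓝[≠] d) := by
      refine tendsto_nhdsWithin_iff.2 ⟨?_, ?_⟩
      · have : Continuous fun t : ℂ => c * t + d := by fun_prop
        simpa using (this.tendsto 0).mono_left nhdsWithin_le_nhds
      · filter_upwards [self_mem_nhdsWithin] with t ht
        have ht0 : t ≠ 0 := ht
        simp [hc, ht0]
    filter_upwards [ht.eventually (hp.eventually_notMem hS d)] with t ht
    rwa [hp.mem_branchPoints]

/-- Two affine maps with the same composition with `p` agree up to a deck transformation. -/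
lemma affine_eq_of_comp_eq (hp : IsDoublyBranchedCover p S) (hS : S.Finite)
    (h0 : (0 : ℂ) ∈ branchPoints p) {α β α' β' : ℂ} (h : ∀ z, p (α * z + β) = p (α' * z + β')) :
    (α' = α ∧ ∃ l ∈ branchPoints p, β' = β + 2 * l) ∨
      (α' = -α ∧ ∃ l ∈ branchPoints p, β' = -β + 2 * l) := by
  by_contra! H
  -- The sign and the branch point relating the two values depend a priori on the argument. If
  -- neither alternative holds globally, discreteness of the branch points yields an argument near
  -- `0` at which both signs fail.
  have h1 : ¬((α' - α) / 2 = 0 ∧ (β' - β) / 2 ∈ branchPoints p) := fun ⟨ha, hb⟩ =>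
    H.1 (by linear_combination 2 * ha) _ hb (by ring)
  have h2 : ¬((α' + α) / 2 = 0 ∧ (β' + β) / 2 ∈ branchPoints p) := fun ⟨ha, hb⟩ =>
    H.2 (by linear_combination 2 * ha) _ hb (by ring)
  obtain ⟨t, ht1, ht2⟩ := ((hp.eventually_notMem_branchPoints_of_affine hS h1).and
    (hp.eventually_notMem_branchPoints_of_affine hS h2)).exists
  obtain ⟨l, hl, hw | hw⟩ := (hp.eq_iff hS h0).1 (h t)
  · refine ht1 ?_
    convert hl using 1
    linear_combination hw / 2
  · refine ht2 ?_
    convert hl using 1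
    linear_combination hw / 2

end IsDoublyBranchedCover

/-! ### Descent of affine maps to Möbius transformations. -/

lemma continuous_moebius (σ : GL (Fin 2) ℂ) : Continuous fun q : OnePoint ℂ => σ • q := by
  refine continuous_iff_continuousAt.2 fun q => ?_
  have key : ∀ q : OnePoint ℂ, Tendsto (fun t => σ • paramAt q t) (𝓝 0) (𝓝 (σ • q)) := fun q => by
    have := ((holomorphicToSphereAt_paramAt q (z := 0) analyticAt_id).smul σ).1.tendsto
    simpa using this
  induction q using OnePoint.rec with
  | infty =>
    rw [OnePoint.continuousAt_infty', coclosedCompact_eq_cocompact, ← Metric.cobounded_eq_cocompact]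
    refine ((key ∞).comp tendsto_inv₀_cobounded).congr' ?_
    have hne : ∀ᶠ t in Bornology.cobounded ℂ, t ∉ ({0} : Set ℂ) :=
      Bornology.isBounded_def.1 (Set.finite_singleton (0 : ℂ)).isBounded
    filter_upwards [hne] with t ht
    have ht0 : t ≠ 0 := ht
    simp [paramAt_infty, ht0]
  | coe a =>
    rw [OnePoint.continuousAt_coe]
    have h1 : Tendsto (fun t : ℂ => t - a) (𝓝 a) (𝓝 0) := by
      have : Continuous fun t : ℂ => t - a := by fun_prop
      simpa using this.tendsto a
    refine ((key a).comp h1).congr fun t => ?_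
    simp

/-- A Möbius transformation as a homeomorphism of the sphere. -/
noncomputable def moebiusHomeomorph (σ : GL (Fin 2) ℂ) : OnePoint ℂ ≃ₜ OnePoint ℂ where
  toEquiv := MulAction.toPerm σ
  continuous_toFun := continuous_moebius σ
  continuous_invFun := continuous_moebius σ⁻¹

lemma IsDoublyBranchedCover.smul {p : ℂ → OnePoint ℂ} {S : Set (OnePoint ℂ)}
    (hp : IsDoublyBranchedCover p S) (σ : GL (Fin 2) ℂ) :
    IsDoublyBranchedCover (fun z => σ • p z) (σ • S) where
  holomorphic := isHolomorphicToSphere_iff.2 fun z => (hp.holomorphic.at z).smul σ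
  branchedCover := by
    refine ⟨(MulAction.surjective σ).comp hp.branchedCover.1, fun y => ?_⟩
    obtain ⟨ψ, hy, hy0, hψt, h⟩ := hp.branchedCover.2 (σ⁻¹ • y)
    have hsrc : ((moebiusHomeomorph σ⁻¹).transOpenPartialHomeomorph ψ).source =
        {w | σ⁻¹ • w ∈ ψ.source} := rfl
    have hpre : (fun z => σ • p z) ⁻¹' {w | σ⁻¹ • w ∈ ψ.source} = p ⁻¹' ψ.source := by
      ext z; simp
    refine ⟨(moebiusHomeomorph σ⁻¹).transOpenPartialHomeomorph ψ, hy, hy0, hψt, ?_⟩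
    rw [hsrc, hpre]
    intro x hx
    obtain ⟨k, hk, φ, hφs, hφt, hφ⟩ := h x hx
    refine ⟨k, hk, φ, hφs, hφt, fun v hv => ?_⟩
    rw [← hφ v hv]
    change ψ (σ⁻¹ • σ • p v) = _
    rw [inv_smul_smul]
  degree_over z hz := by
    rw [localDegree_smul σ (hp.holomorphic.at z)]
    exact hp.degree_over z (Set.smul_mem_smul_set_iff.1 hz)
  degree_off z hz := by
    rw [localDegree_smul σ (hp.holomorphic.at z)]
    exact hp.degree_off z fun h => hz (Set.smul_mem_smul_set_iff.2 h)

/-- Every value has a holomorphic branch of the inverse in terms of an `n`-th root of the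
coordinate, with `n = 1` away from `S`. -/
def HasRootSections (q : ℂ → OnePoint ℂ) (S : Set (OnePoint ℂ)) : Prop :=
  ∀ y, ∃ (n : ℕ) (s : ℂ → ℂ), n ≠ 0 ∧ (y ∉ S → n = 1) ∧ AnalyticAt ℂ s 0 ∧
    ∀ᶠ u in 𝓝 0, q (s u) = paramAt y (u ^ n)

lemma IsDoublyBranchedCover.hasRootSections {q : ℂ → OnePoint ℂ} {S : Set (OnePoint ℂ)}
    (hq : IsDoublyBranchedCover q S) : HasRootSections q S := fun y => by
  obtain ⟨c, rfl⟩ := hq.branchedCover.1 y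
  obtain ⟨n, hn, -, hdeg⟩ := hq.exists_degree c
  obtain ⟨k, s, -, -, hs, -, -, hqs, -, -⟩ := exists_normalForm (hq.holomorphic.at c) hn hdeg
  refine ⟨n, s, hn, fun h => ?_, hs, hqs⟩
  have := hq.degree_off c h
  rw [hdeg] at this
  exact_mod_cast this

/-- This stability lets the descent argument be applied to `z ↦ q (a z + b)` without showing that it
is a branched cover. -/
lemma HasRootSections.comp_affine {q : ℂ → OnePoint ℂ} {S : Set (OnePoint ℂ)}
    (hq : HasRootSections q S) {a : ℂ} (ha : a ≠ 0) (b : ℂ) :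
    HasRootSections (fun z => q (a * z + b)) S := fun y => by
  obtain ⟨n, s, hn, h1, hs, hqs⟩ := hq y
  refine ⟨n, fun u => (s u - b) / a, hn, h1, (hs.sub analyticAt_const).div_const, ?_⟩
  filter_upwards [hqs] with u hu
  rw [mul_div_cancel₀ _ ha, sub_add_cancel, hu]

lemma HasRootSections.surjective {q : ℂ → OnePoint ℂ} {S : Set (OnePoint ℂ)}
    (hq : HasRootSections q S) : Function.Surjective q := fun y => by
  obtain ⟨n, s, hn, -, -, hqs⟩ := hq y
  exact ⟨s 0, by rw [hqs.self_of_nhds]; simp [hn]⟩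

/-- A holomorphic map constant on the fibres of `p`, with no pole over the finite plane, descends to
an entire function. -/
lemma HasRootSections.exists_entire_factor {p g : ℂ → OnePoint ℂ} {S : Set (OnePoint ℂ)}
    (hp : HasRootSections p S) (hS : S.Finite) (hg : IsHolomorphicToSphere g)
    (hfib : ∀ z w, p z = p w → g z = g w) (hpole : ∀ z, g z = ∞ → p z = ∞) :
    ∃ k : ℂ → ℂ, Differentiable ℂ k ∧ ∀ (z a : ℂ), p z = a → g z = (k a : ℂ) := by
  have hex : ∀ a : ℂ, ∃ b : ℂ, ∀ z, p z = a → g z = b := fun a => by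
    obtain ⟨z, hz⟩ := hp.surjective (a : OnePoint ℂ)
    obtain ⟨b, hb⟩ := OnePoint.ne_infty_iff_exists.1
      fun h => OnePoint.coe_ne_infty a (hz ▸ hpole z h)
    exact ⟨b, fun w hw => by rw [hb]; exact hfib w z (by rw [hw, hz])⟩
  choose k hk using hex
  have hsec : ∀ a : ℂ, ∃ n : ℕ, n ≠ 0 ∧ ((a : OnePoint ℂ) ∉ S → n = 1) ∧
      AnalyticAt ℂ (fun u => k (a + u ^ n)) 0 := fun a => by
    obtain ⟨n, s, hn, h1, hs, hps⟩ := hp (a : OnePoint ℂ)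
    refine ⟨n, hn, h1, ?_⟩
    have hgs : HolomorphicToSphereAt (fun u => g (s u)) 0 := (hg.at (s 0)).comp hs
    have hval : ∀ᶠ u in 𝓝 (0 : ℂ), g (s u) = (k (a + u ^ n) : ℂ) := by
      filter_upwards [hps] with u hu
      exact hk _ _ (by rw [hu, paramAt_coe])
    have h0 : g (s 0) = (k a : ℂ) := by
      rw [hval.self_of_nhds, zero_pow hn, add_zero]
    refine (hgs.2.add (analyticAt_const (v := k a))).congr ?_
    filter_upwards [hval] with u hu
    change coordAt (g (s 0)) (g (s u)) + k a = _
    rw [hu, h0, coordAt_coe_coe, sub_add_cancel]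
  -- An arbitrary choice of `n`-th roots tends to `0` at `0`, so continuity in the root variable `u`
  -- gives continuity of `k` at `a`.
  have hcont : ∀ a, ContinuousAt k a := fun a => by
    obtain ⟨n, hn, -, han⟩ := hsec a
    choose r hr using fun x : ℂ => IsAlgClosed.exists_pow_nat_eq x (Nat.pos_of_ne_zero hn)
    have hrt : Tendsto r (𝓝 0) (𝓝 0) := by
      refine Metric.tendsto_nhds.2 fun ε hε => ?_
      filter_upwards [ball_mem_nhds (0 : ℂ) (pow_pos hε n)] with t ht
      rw [dist_zero_right]
      refine lt_of_pow_lt_pow_left₀ n hε.le ?_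
      rw [← norm_pow, hr]
      simpa using ht
    have h1 : Tendsto (fun t : ℂ => t - a) (𝓝 a) (𝓝 0) := by
      have : Continuous fun t : ℂ => t - a := by fun_prop
      simpa using this.tendsto a
    have h2 := (han.continuousAt.tendsto.comp (hrt.comp h1))
    rw [zero_pow hn, add_zero] at h2
    refine h2.congr fun t => ?_
    simp [hr]
  refine ⟨k, fun a => AnalyticAt.differentiableAt ?_, fun z a => hk a z⟩
  -- Near `a`, but off `a`, the finite set `S` is avoided and `n = 1`, so `k` is analytic there; the
  -- singularity at `a` is removable.
  refine Complex.analyticAt_of_differentiable_on_punctured_nhds_of_continuousAt ?_ (hcont a)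
  have hfin : (((↑) : ℂ → OnePoint ℂ) ⁻¹' S \ {a}).Finite :=
    (hS.preimage (OnePoint.coe_injective.injOn)).subset Set.sdiff_subset
  filter_upwards [nhdsWithin_le_nhds (hfin.isClosed.isOpen_compl.mem_nhds (x := a) (by simp)),
    self_mem_nhdsWithin] with t ht hta
  have htS : (t : OnePoint ℂ) ∉ S := fun h => ht ⟨h, hta⟩
  obtain ⟨n, -, h1, han⟩ := hsec t
  rw [h1 htS] at han
  have hsub : AnalyticAt ℂ (fun x : ℂ => x - t) t := by fun_prop
  have := AnalyticAt.comp (g := fun u => k (t + u ^ 1)) (f := fun x : ℂ => x - t) (x := t)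
    (by simpa using han) hsub
  refine (this.congr (Eventually.of_forall fun x => ?_)).differentiableAt
  simp

lemma exists_moebius_eq_infty (y : OnePoint ℂ) : ∃ M : GL (Fin 2) ℂ, M • y = ∞ := by
  induction y using OnePoint.rec with
  | infty => exact ⟨1, one_smul _ _⟩
  | coe b =>
    refine ⟨Matrix.GeneralLinearGroup.mkOfDetNeZero !![0, 1; 1, -b] (by simp [Matrix.det_fin_two]), ?_⟩
    rw [OnePoint.smul_some_eq_ite, if_pos]
    simp [Matrix.GeneralLinearGroup.mkOfDetNeZero]

lemma exists_moebius_affine {a : ℂ} (ha : a ≠ 0) (b : ℂ) : ∃ M : GL (Fin 2) ℂ,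
    M • (∞ : OnePoint ℂ) = ∞ ∧ ∀ t : ℂ, M • (t : OnePoint ℂ) = (a * t + b : ℂ) := by
  refine ⟨Matrix.GeneralLinearGroup.mkOfDetNeZero !![a, b; 0, 1] (by simp [Matrix.det_fin_two, ha]),
    ?_, fun t => ?_⟩
  · rw [OnePoint.smul_infty_eq_self_iff]
    simp [Matrix.GeneralLinearGroup.mkOfDetNeZero]
  · rw [OnePoint.smul_some_eq_ite]
    simp [Matrix.GeneralLinearGroup.mkOfDetNeZero]

/-- Two branched covers with the same fibres, up to an affine change of variable, differ by a Möbius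
transformation. -/
lemma IsDoublyBranchedCover.exists_moebius {p p₀ : ℂ → OnePoint ℂ} {S S₀ : Set (OnePoint ℂ)}
    (hp : IsDoublyBranchedCover p S) (hp₀ : IsDoublyBranchedCover p₀ S₀) (hS : S.Finite)
    (hS₀ : S₀.Finite) {a b : ℂ} (ha : a ≠ 0)
    (hfib : ∀ z w, p z = p w ↔ p₀ (a * z + b) = p₀ (a * w + b)) :
    ∃ σ : GL (Fin 2) ℂ, ∀ z, p₀ (a * z + b) = σ • p z := by
  obtain ⟨z₀, hz₀⟩ := hp.branchedCover.1 ∞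
  -- After applying `M`, the fibre over `∞` is the same for both maps, so the descended bijection
  -- has no pole in the finite plane, in either direction.
  obtain ⟨M, hM⟩ := exists_moebius_eq_infty (p₀ (a * z₀ + b))
  have hq := hp₀.smul M
  set g : ℂ → OnePoint ℂ := fun z => M • p₀ (a * z + b) with hg
  have hgfib : ∀ z w, g z = g w ↔ p z = p w := fun z w => by
    rw [hfib]; exact (MulAction.injective M).eq_iff
  have hgz₀ : g z₀ = ∞ := hM
  have hinf : ∀ z, g z = ∞ ↔ p z = ∞ := fun z => by
    have := hgfib z z₀
    rwa [hgz₀, hz₀] at this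
  have hghol : IsHolomorphicToSphere g := isHolomorphicToSphere_iff.2 fun z =>
    (hq.holomorphic.at (a * z + b)).comp (h := fun z => a * z + b) (by fun_prop)
  have hgsec : HasRootSections g (M • S₀) := hq.hasRootSections.comp_affine ha b
  obtain ⟨k, hk, hkp⟩ := hp.hasRootSections.exists_entire_factor hS hghol
    (fun z w h => (hgfib z w).2 h) fun z h => (hinf z).1 h
  obtain ⟨k', hk', hkg⟩ := hgsec.exists_entire_factor (hS₀.image _) hp.holomorphic
    (fun z w h => (hgfib z w).1 h) fun z h => (hinf z).2 h
  have h1 : ∀ x, k' (k x) = x := fun x => by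
    obtain ⟨z, hz⟩ := hp.branchedCover.1 (x : OnePoint ℂ)
    have := hkg z _ (hkp z x hz)
    rw [hz] at this
    exact (OnePoint.coe_injective this).symm
  have h2 : ∀ x, k (k' x) = x := fun x => by
    obtain ⟨z, hz⟩ := hgsec.surjective (x : OnePoint ℂ)
    have := hkp z _ (hkg z x hz)
    rw [hz] at this
    exact (OnePoint.coe_injective this).symm
  obtain ⟨c, d, hc, hcd⟩ := exists_affine_of_entire_inverse hk hk' h1 h2
  obtain ⟨N, hN, hNt⟩ := exists_moebius_affine hc d
  have hNg : ∀ z, g z = N • p z := fun z => by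
    rcases eq_or_ne (p z) ∞ with hpz | hpz
    · rw [hpz, hN]; exact (hinf z).2 hpz
    · obtain ⟨t, ht⟩ := OnePoint.ne_infty_iff_exists.1 hpz
      rw [← ht, hNt, ← hcd]; exact hkp z t ht.symm
  refine ⟨M⁻¹ * N, fun z => ?_⟩
  rw [mul_smul, ← hNg, inv_smul_smul]

/-! ### The two directions of the theorem. -/

lemma AnalyticallyConjugate.exists_eq {f f₀ : OnePoint ℂ → OnePoint ℂ}
    (h : AnalyticallyConjugate f f₀) : ∃ σ : GL (Fin 2) ℂ, f₀ = fun x => σ • f (σ⁻¹ • x) :=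
  let ⟨σ, hσ⟩ := h
  ⟨σ, funext hσ⟩

lemma liftDataRelated_of_conjugate {f : OnePoint ℂ → OnePoint ℂ} (hf : IsLattes f)
    {p : ℂ → OnePoint ℂ} (hp : IsDoublyBranchedCover p (postcriticalSet f))
    (h0 : (0 : ℂ) ∈ branchPoints p) {α β : ℂ} (hlift : IsAffineLift p f α β)
    {f₀ : OnePoint ℂ → OnePoint ℂ} {p₀ : ℂ → OnePoint ℂ} {α₀ β₀ : ℂ}
    (hconj : AnalyticallyConjugate f f₀)
    (hp₀ : IsDoublyBranchedCover p₀ (postcriticalSet f₀)) (h0₀ : (0 : ℂ) ∈ branchPoints p₀)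
    (hlift₀ : IsAffineLift p₀ f₀ α₀ β₀) :
    LiftDataRelated α β (branchPoints p) α₀ β₀ (branchPoints p₀) := by
  obtain ⟨σ, rfl⟩ := hconj.exists_eq
  rw [postcriticalSet_conj σ hf.rational] at hp₀
  have hS : (postcriticalSet f).Finite := Set.finite_of_ncard_ne_zero (by rw [hf.four]; norm_num)
  have hS₀ : (σ • postcriticalSet f).Finite := hS.image _
  have hp₁ := hp.smul σ
  obtain ⟨w, hw⟩ := hp₀.branchedCover.1 (σ • p 0)
  obtain ⟨γ, c, hγ, hγc, -⟩ := hp₁.exists_affine_of_eq hp₀ hS₀ (z := 0) hw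
  have hmem : ∀ t, γ * t + c ∈ branchPoints p₀ ↔ t ∈ branchPoints p := fun t => by
    rw [hp₀.mem_branchPoints, hp.mem_branchPoints, hγc, Set.smul_mem_smul_set_iff]
  have hc : c ∈ branchPoints p₀ := by simpa using (hmem 0).2 h0
  have hΛ : ∀ x, x ∈ branchPoints p₀ ↔ γ⁻¹ * x ∈ branchPoints p := fun x => by
    rw [← hmem, mul_inv_cancel_left₀ hγ]
    refine ⟨fun h => hp₀.add_mem_branchPoints hS₀ h0₀ h hc, fun h => ?_⟩
    simpa using hp₀.sub_mem_branchPoints hS₀ h0₀ h hc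
  -- The map on the left is the conjugate of `α z + β` by `γ z + c`, hence a second lift of the
  -- conjugated map through `p₀`.
  have hcomp : ∀ z, p₀ (α * z + (γ * β + c - α * c)) = p₀ (α₀ * z + β₀) := fun z => by
    have hz : z = γ * (γ⁻¹ * (z - c)) + c := by rw [mul_inv_cancel_left₀ hγ]; ring
    rw [hlift₀ z]
    conv_rhs =>
      rw [hz, hγc]
      beta_reduce
      rw [inv_smul_smul, ← hlift, ← hγc]
    congr 1
    rw [mul_add, mul_left_comm, mul_inv_cancel_left₀ hγ]
    ring
  have hsmul : ∀ g : ℂ, g ≠ 0 → (∀ x, x ∈ branchPoints p₀ ↔ g⁻¹ * x ∈ branchPoints p) →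
      branchPoints p₀ = g • branchPoints p := fun g hg h => by
    ext x
    rw [Set.mem_smul_set_iff_inv_smul_mem₀ hg, h, smul_eq_mul]
  rcases hp₀.affine_eq_of_comp_eq hS₀ h0₀ hcomp with ⟨ha, l, hl, hb⟩ | ⟨ha, l, hl, hb⟩
  -- This `δ` is `c - αc + 2l`, rewritten to display the factor `α + 1`.
  · refine ⟨Or.inl ha, γ, hγ, ⟨(α + 1) * (-c) + 2 * (c + l), ?_, ?_⟩, hsmul γ hγ hΛ⟩
    · exact Set.add_mem_add
        (Set.smul_mem_smul_set (hp₀.neg_mem_branchPoints hS₀ h0₀ hc))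
        (Set.smul_mem_smul_set (hp₀.add_mem_branchPoints hS₀ h0₀ hc hl))
    · rw [hb]; ring
  · refine ⟨Or.inr ha, -γ, neg_ne_zero.2 hγ, ⟨(α + 1) * c + 2 * (l - c), ?_, ?_⟩,
      hsmul (-γ) (neg_ne_zero.2 hγ) fun x => ?_⟩
    · exact Set.add_mem_add (Set.smul_mem_smul_set hc)
        (Set.smul_mem_smul_set (hp₀.sub_mem_branchPoints hS₀ h0₀ hl hc))
    · rw [hb]; ring
    · rw [hΛ, inv_neg, neg_mul]
      refine ⟨hp.neg_mem_branchPoints hS h0, fun h => ?_⟩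
      simpa using hp.neg_mem_branchPoints hS h0 h

/-- An affine change of variable matching the branch points descends to a Möbius transformation that
conjugates the Lattès map. -/
lemma exists_conjugate_of_affine {f : OnePoint ℂ → OnePoint ℂ} (hf : IsLattes f)
    {p : ℂ → OnePoint ℂ} (hp : IsDoublyBranchedCover p (postcriticalSet f))
    (h0 : (0 : ℂ) ∈ branchPoints p) {α β : ℂ} (hlift : IsAffineLift p f α β)
    {p₀ : ℂ → OnePoint ℂ} {S₀ : Set (OnePoint ℂ)} (hS₀ : S₀.Finite)
    (hp₀ : IsDoublyBranchedCover p₀ S₀) (h0₀ : (0 : ℂ) ∈ branchPoints p₀) {a b : ℂ} (ha : a ≠ 0)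
    (hb : b ∈ branchPoints p₀) (hΛ : branchPoints p₀ = a • branchPoints p) :
    ∃ f₀ : OnePoint ℂ → OnePoint ℂ, IsLattes f₀ ∧ postcriticalSet f₀ = S₀ ∧
      AnalyticallyConjugate f f₀ ∧ IsAffineLift p₀ f₀ α (a * β + b - α * b) := by
  have hS : (postcriticalSet f).Finite := Set.finite_of_ncard_ne_zero (by rw [hf.four]; norm_num)
  have hmem : ∀ x, a * x ∈ branchPoints p₀ ↔ x ∈ branchPoints p := fun x => by
    rw [hΛ, Set.mem_smul_set_iff_inv_smul_mem₀ ha, smul_eq_mul, inv_mul_cancel_left₀ ha]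
  have hmem' : ∀ x, a * x + b ∈ branchPoints p₀ ↔ x ∈ branchPoints p := fun x => by
    rw [← hmem]
    refine ⟨fun h => ?_, fun h => hp₀.add_mem_branchPoints hS₀ h0₀ h hb⟩
    simpa using hp₀.sub_mem_branchPoints hS₀ h0₀ h hb
  -- Conjugation by `a z + b` turns translation by `2l` into translation by `2al`, and the half-turn
  -- about `l` into the one about `al + b`; both `al` and `al + b` are branch points of `p₀` exactly
  -- when `l` is one of `p`.
  have hfib : ∀ z w, p z = p w ↔ p₀ (a * z + b) = p₀ (a * w + b) := fun z w => by
    rw [hp.eq_iff hS h0, hp₀.eq_iff hS₀ h0₀]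
    constructor
    · rintro ⟨l, hl, rfl | rfl⟩
      · exact ⟨a * l, (hmem l).2 hl, Or.inl (by ring)⟩
      · exact ⟨a * l + b, (hmem' l).2 hl, Or.inr (by ring)⟩
    · rintro ⟨m, hm, h | h⟩
      · refine ⟨a⁻¹ * m, (hmem _).1 (by rwa [mul_inv_cancel_left₀ ha]), Or.inl ?_⟩
        refine mul_left_cancel₀ ha ?_
        rw [mul_add, mul_left_comm a 2, mul_inv_cancel_left₀ ha]
        linear_combination h
      · refine ⟨a⁻¹ * (m - b), (hmem _).1 ?_, Or.inr ?_⟩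
        · rw [mul_inv_cancel_left₀ ha]; exact hp₀.sub_mem_branchPoints hS₀ h0₀ hm hb
        · refine mul_left_cancel₀ ha ?_
          rw [mul_add, mul_left_comm a 2, mul_inv_cancel_left₀ ha]
          linear_combination h
  obtain ⟨σ, hσ⟩ := hp.exists_moebius hp₀ hS hS₀ ha hfib
  have hcoord : ∀ z, z = a * (a⁻¹ * (z - b)) + b := fun z => by
    rw [mul_inv_cancel_left₀ ha]; ring
  refine ⟨fun x => σ • f (σ⁻¹ • x), hf.conj σ, ?_, ⟨σ, fun _ => rfl⟩, fun z => ?_⟩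
  · rw [postcriticalSet_conj σ hf.rational]
    ext x
    obtain ⟨z, rfl⟩ := hp₀.branchedCover.1 x
    rw [hcoord z, ← hp₀.mem_branchPoints, hmem', hσ, Set.smul_mem_smul_set_iff, hp.mem_branchPoints]
  · conv_rhs =>
      rw [hcoord z, hσ]
      beta_reduce
      rw [inv_smul_smul, ← hlift, ← hσ]
    congr 1
    rw [mul_add, mul_left_comm, mul_inv_cancel_left₀ ha]
    ring

theorem lemma1p1
    (f : OnePoint ℂ → OnePoint ℂ) (hf : IsLattes f)
    (p : ℂ → OnePoint ℂ) (hp : IsDoublyBranchedCover p (postcriticalSet f))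
    (h0 : (0 : ℂ) ∈ branchPoints p)
    (α β : ℂ) (hlift : IsAffineLift p f α β) :
    (∀ (f₀ : OnePoint ℂ → OnePoint ℂ) (p₀ : ℂ → OnePoint ℂ) (α₀ β₀ : ℂ),
      IsLattes f₀ → AnalyticallyConjugate f f₀ →
      IsDoublyBranchedCover p₀ (postcriticalSet f₀) → (0 : ℂ) ∈ branchPoints p₀ →
      IsAffineLift p₀ f₀ α₀ β₀ →
      LiftDataRelated α β (branchPoints p) α₀ β₀ (branchPoints p₀)) ∧
    (∀ (p₀ : ℂ → OnePoint ℂ) (S₀ : Set (OnePoint ℂ)) (α₀ β₀ : ℂ),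
      S₀.ncard = 4 → IsDoublyBranchedCover p₀ S₀ → (0 : ℂ) ∈ branchPoints p₀ →
      LiftDataRelated α β (branchPoints p) α₀ β₀ (branchPoints p₀) →
      ∃ f₀ : OnePoint ℂ → OnePoint ℂ,
        IsLattes f₀ ∧ postcriticalSet f₀ = S₀ ∧ AnalyticallyConjugate f f₀ ∧
        IsAffineLift p₀ f₀ α₀ β₀) := by
  refine ⟨fun f₀ p₀ α₀ β₀ _ hconj hp₀ h0₀ hlift₀ =>
    liftDataRelated_of_conjugate hf hp h0 hlift hconj hp₀ h0₀ hlift₀, ?_⟩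
  rintro p₀ S₀ α₀ β₀ hcard hp₀ h0₀ ⟨hα, γ, hγ, ⟨δ, hδ, hβ⟩, hΛ⟩
  have hS : (postcriticalSet f).Finite := Set.finite_of_ncard_ne_zero (by rw [hf.four]; norm_num)
  have hS₀ : S₀.Finite := Set.finite_of_ncard_ne_zero (by rw [hcard]; norm_num)
  obtain ⟨_, ⟨l, hl, rfl⟩, _, ⟨m, hm, rfl⟩, rfl⟩ := hδ
  simp only [smul_eq_mul] at hβ
  have hlm := hp₀.add_mem_branchPoints hS₀ h0₀ hl hm
  rcases hα with rfl | rfl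
  -- With `δ = (α + 1)l + 2m`, conjugation by `γ z - l` yields the constant term `γβ + (α + 1)l -
  -- 2l`, which differs from `β₀` by the period `2(l + m)`.
  · obtain ⟨f₀, hf₀, hP, hconj, hl₀⟩ := exists_conjugate_of_affine hf hp h0 hlift hS₀ hp₀ h0₀ hγ
      (hp₀.neg_mem_branchPoints hS₀ h0₀ hl) hΛ
    refine ⟨f₀, hf₀, hP, hconj, fun z => ?_⟩
    rw [← hl₀ z, ← hp₀.apply_add_two_mul hS₀ h0₀ hlm (_ + (_ + -l - _)), hβ]
    congr 1
    ring
  · have hΛ' : branchPoints p₀ = (-γ) • branchPoints p := by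
      rw [hΛ]
      ext x
      rw [Set.mem_smul_set_iff_inv_smul_mem₀ hγ,
        Set.mem_smul_set_iff_inv_smul_mem₀ (neg_ne_zero.2 hγ), inv_neg, neg_smul]
      refine ⟨hp.neg_mem_branchPoints hS h0, fun h => ?_⟩
      simpa using hp.neg_mem_branchPoints hS h0 h
    -- Conjugation by `-γ z + l` gives the negative of the required map up to the period `2(l + m)`,
    -- and `p₀` is even.
    obtain ⟨f₀, hf₀, hP, hconj, hl₀⟩ := exists_conjugate_of_affine hf hp h0 hlift hS₀ hp₀ h0₀
      (neg_ne_zero.2 hγ) hl hΛ'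
    refine ⟨f₀, hf₀, hP, hconj, fun z => ?_⟩
    rw [← hl₀ z, ← hp₀.apply_neg hS₀ h0₀, ← hp₀.apply_add_two_mul hS₀ h0₀ hlm, hβ]
    congr 1
    ring
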